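/- Let $n\to\infty$ and $p\to\infty$, and consider the linear regression model $Y_i=\sum_{j=1}^p\theta_jX_{ij}+\xi_i$, $1\le i\le n$, where $\theta=(\theta_1,\dots,\theta_p)\in\mathbb R^p$ is unknown, the $\xi_i$ are i.i.d. $\mathcal N(0,1)$ and independent of the random design $X=(X_{ij})$, and where, for each $j$, the $X_{1j},\dots,X_{nj}$ are identically distributed with $E X_{ij}=0$ and $E X_{ij}^2=1$ (the law of $X$ may depend on $n$ and $p$). Assume that (A2) all the random variables $X_{ij}$, $1\le i\le n$, $1\le j\le p$, are independent; (B1) $\max_{1\le j<l\le p}E\big[(X_{ij}X_{il})^4\big]=O(1)$ (this expectation does not depend on $i$). Let $P_\theta$ and $E_\theta$ denote the law of $Z=(X,Y)$ and the expectation when the parameter is $\theta$. Consider the U-statistic $$t_1=N^{-1/2}\sum_{1\le i<k\le n}p^{-1/2}\,Y_iY_k\sum_{j=1}^pX_{ij}X_{kj},\qquad N=\frac{n(n-1)}2,$$ and, for $\alpha\in(0,1)$, the test $\psi^1_\alpha=\mathbf 1_{\{t_1>u_\alpha\}}$ of $H_0:\theta=0$, where $u_\alpha$ is the $(1-\alpha)$-quantile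 of the standard Gaussian distribution. For $r>0$ let $\Theta_p(r)=\{\theta\in\mathbb R^p:\|\theta\|\ge r\}$, where $\|\cdot\|$ is the Euclidean norm. Then for every $\alpha\in(0,1)$: (i) the type I error satisfies $E_0\psi^1_\alpha=\alpha+o(1)$; (ii) if $p=o(n^2)$ and the radii $r_{np}>0$ satisfy $n r_{np}^2/\sqrt p\to\infty$, then the maximal type II error satisfies $\sup_{\theta\in\Theta_p(r_{np})}E_\theta(1-\psi^1_\alpha)\to0$. -/

import Mathlib

open MeasureTheory ProbabilityTheory Filter Topology

noncomputable section

namespace SparseRegression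

/-- The space of design matrices `X = (X i j)`, `n` observations (rows), `p` regressors (columns). -/
abbrev Design (n p : ℕ) : Type := Fin n → Fin p → ℝ

/-- The space of the observations `Z = (X, Y)`. -/
abbrev Obs (n p : ℕ) : Type := Design n p × (Fin n → ℝ)

/-- Standing assumptions on the law `PX` of the random design: in each column `j` the entries
`X i j` are independent and identically distributed, with `E (X i j) = 0` and `E (X i j) ^ 2 = 1`
(the second moment being `1`, hence nonzero, the entries are square integrable). -/
structure IsStandardDesign {n p : ℕ} (PX : Measure (Design n p)) : Prop where
  identDistrib : ∀ (j : Fin p) (i i' : Fin n),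
    IdentDistrib (fun X : Design n p => X i j) (fun X : Design n p => X i' j) PX PX
  indep_column : ∀ j : Fin p, iIndepFun (fun (i : Fin n) (X : Design n p) => X i j) PX
  mean_zero : ∀ (i : Fin n) (j : Fin p), ∫ X, X i j ∂PX = 0
  second_moment_one : ∀ (i : Fin n) (j : Fin p), ∫ X, (X i j) ^ 2 ∂PX = 1

/-- Independent design: all the entries `X i j` are jointly independent. -/
def IndependentDesign {n p : ℕ} (PX : Measure (Design n p)) : Prop :=
  iIndepFun (fun (q : Fin n × Fin p) (X : Design n p) => X q.1 q.2) PX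

/-- Fourth moment condition, along the limit `l`:
`max_{j < j'} E ((X i j * X i j') ^ 4) = O(1)`. The expectations take values in `[0, ∞]`,
so that their finiteness is part of the condition. -/
def BoundedProductMoments {ι : Type*} (l : Filter ι) (n p : ι → ℕ)
    (PX : ∀ m, Measure (Design (n m) (p m))) : Prop :=
  ∃ C : NNReal, ∀ᶠ m in l, ∀ (i : Fin (n m)) (j j' : Fin (p m)), j < j' →
    ∫⁻ X, ENNReal.ofReal ((X i j * X i j') ^ 4) ∂(PX m) ≤ C

/-- The response `Y i = ∑ j, θ j * X i j + ξ i`. -/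
def response {n p : ℕ} (θ : EuclideanSpace ℝ (Fin p)) (X : Design n p) (ξ : Fin n → ℝ) :
    Fin n → ℝ :=
  fun i => ∑ j, θ j * X i j + ξ i

/-- The law `P_θ` of `Z = (X, Y)`, where `X` has law `PX` and is independent of the noise `ξ`,
whose coordinates are i.i.d. standard Gaussian. -/
def modelLaw {n p : ℕ} (PX : Measure (Design n p)) (θ : EuclideanSpace ℝ (Fin p)) :
    Measure (Obs n p) :=
  (PX.prod (Measure.pi fun _ : Fin n => gaussianReal 0 1)).map
    fun w => (w.1, response θ w.1 w.2)

/-- Type I error probability `E_0 ψ` of a test `ψ`. -/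
def typeIError {n p : ℕ} (PX : Measure (Design n p)) (ψ : Obs n p → ℝ) : ℝ :=
  ∫ Z, ψ Z ∂(modelLaw PX 0)

/-- Type II error probability `E_θ (1 - ψ)` of a test `ψ` at `θ`. -/
def typeIIErrorAt {n p : ℕ} (PX : Measure (Design n p)) (ψ : Obs n p → ℝ)
    (θ : EuclideanSpace ℝ (Fin p)) : ℝ :=
  ∫ Z, (1 - ψ Z) ∂(modelLaw PX θ)

/-- Maximal type II error probability `sup_{θ ∈ Θ} E_θ (1 - ψ)` of a test `ψ` over `Θ`. -/
def typeIIError {n p : ℕ} (PX : Measure (Design n p)) (ψ : Obs n p → ℝ)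
    (Θ : Set (EuclideanSpace ℝ (Fin p))) : ℝ :=
  ⨆ θ : Θ, typeIIErrorAt PX ψ θ

/-- The alternative `Θ_p(r)`: vectors of Euclidean norm at least `r`. -/
def alternative (p : ℕ) (r : ℝ) : Set (EuclideanSpace ℝ (Fin p)) :=
  {θ | r ≤ ‖θ‖}

/-- The kernel `K (Z_i, Z_k) = p^{-1/2} Y_i Y_k ∑_j X_{ij} X_{kj}`. -/
def kernelK {n p : ℕ} (Z : Obs n p) (i k : Fin n) : ℝ :=
  (Real.sqrt p)⁻¹ * (Z.2 i * Z.2 k * ∑ j, Z.1 i j * Z.1 k j)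

/-- The U-statistic `t₁ = N^{-1/2} ∑_{i < k} K (Z_i, Z_k)`, `N = n (n - 1) / 2`. -/
def statT1 {n p : ℕ} (Z : Obs n p) : ℝ :=
  (Real.sqrt ((n : ℝ) * ((n : ℝ) - 1) / 2))⁻¹ *
    ∑ q : Fin n × Fin n with q.1 < q.2, kernelK Z q.1 q.2

/-- `u_α`, the `(1 - α)`-quantile of the standard Gaussian distribution. -/
def gaussianUpperQuantile (α : ℝ) : ℝ :=
  sInf {x : ℝ | 1 - α ≤ cdf (gaussianReal 0 1) x}

/-- The test `ψ_α^1`, the indicator of `t₁ > u_α`. -/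
def testPsi1 (n p : ℕ) (α : ℝ) : Obs n p → ℝ :=
  Set.indicator {Z | gaussianUpperQuantile α < statT1 Z} 1

end SparseRegression

end

/-! Put `V_i = Y_i X_i`. Up to the factor `(N p)^{-1/2}`, `t₁` is the sum of `⟨V_i, V_k⟩` over `i <
k`. Moments of such forms are found by exposing one variable at a time: given the others, the form
is affine in the new one.

Type I. At `θ = 0` one has `Y = ξ`. Given `ξ`, exchanging sums turns `t₁` into a normalized sum over
columns `j` of the forms `W_j = ∑_{i<k} ξ_i ξ_k X_{ij} X_{kj}`. These are independent and centered,
with common variance `v(ξ) = ∑_{i<k} ξ_i² ξ_k²` and fourth moment `O((∑ ξ_i²)⁴)`. A Taylor expansion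
of characteristic functions gives a conditional CLT with error of order `p^{-1/2}`
(`norm_charFun_sum_columns_sub_le`). Since `v(ξ)/N` is within `O(n^{-1/2})` of `1` in mean square
norm, averaging over `ξ` gives `exists_charFun_statT1_bound`, and `exists_delta_of_charFun_bound`
passes to tail probabilities.

Type II. The `V_i` are i.i.d. with mean `θ` and `E⟨V_i, v⟩² ≤ λ‖v‖²`, where `λ = 1 + 4C‖θ‖²`. By the
Hoeffding decomposition the U-statistic has mean `N‖θ‖²` and mean square deviation at most `2n³λ‖θ‖²
+ 2n²λ²p`. Chebyshev at half the mean, with `λ ≤ (4C + 1/r²)‖θ‖²`, gives a bound free of `θ`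
(`typeIIErrorAt_le`), which tends to zero under the rate conditions. -/

namespace SparseRegression

/-! ### Integrating out the first coordinate of a product measure -/

section PiFubini

variable {E : Type*} [MeasurableSpace E]

theorem measurePreserving_finCons {n : ℕ} (μ : Fin (n + 1) → Measure E)
    [∀ i, IsProbabilityMeasure (μ i)] :
    MeasurePreserving (fun z : E × (Fin n → E) => (Fin.cons z.1 z.2 : Fin (n + 1) → E))
      ((μ 0).prod (Measure.pi fun i => μ i.succ)) (Measure.pi μ) := by
  have h := (measurePreserving_piFinSuccAbove (α := fun _ : Fin (n + 1) => E) μ 0).symm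
  have e : (fun z : E × (Fin n → E) => (Fin.cons z.1 z.2 : Fin (n + 1) → E)) =
      (MeasurableEquiv.piFinSuccAbove (fun _ : Fin (n + 1) => E) 0).symm := by
    ext z i
    simp [MeasurableEquiv.piFinSuccAbove_symm_apply, Fin.insertNthEquiv]
  rw [e]
  simpa only [Fin.zero_succAbove] using h

theorem lintegral_pi_succ {n : ℕ} (μ : Fin (n + 1) → Measure E)
    [∀ i, IsProbabilityMeasure (μ i)] {f : (Fin (n + 1) → E) → ENNReal} (hf : Measurable f) :
    ∫⁻ v, f v ∂(Measure.pi μ) =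
      ∫⁻ y, ∫⁻ x, f (Fin.cons x y) ∂(μ 0) ∂(Measure.pi fun i : Fin n => μ i.succ) := by
  have h := measurePreserving_finCons μ
  rw [← h.lintegral_comp hf]
  exact lintegral_prod_symm _ (hf.comp h.measurable).aemeasurable

theorem integral_pi_succ {n : ℕ} (μ : Fin (n + 1) → Measure E)
    [∀ i, IsProbabilityMeasure (μ i)] {f : (Fin (n + 1) → E) → ℝ} (hf : Measurable f)
    (hi : Integrable f (Measure.pi μ)) :
    ∫ v, f v ∂(Measure.pi μ) =
      ∫ y, ∫ x, f (Fin.cons x y) ∂(μ 0) ∂(Measure.pi fun i : Fin n => μ i.succ) := by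
  have h := measurePreserving_finCons μ
  rw [← h.map_eq, integral_map h.measurable.aemeasurable hf.aestronglyMeasurable]
  refine integral_prod_symm _ ?_
  exact h.integrable_comp_of_integrable hi

end PiFubini

/-- The sum of the inner products of the pairs of distinct entries of a finite sequence. -/
def pairInner {E : Type*} [NormedAddCommGroup E] [InnerProductSpace ℝ E] {n : ℕ}
    (v : Fin n → E) : ℝ :=
  ∑ q : Fin n × Fin n with q.1 < q.2, inner ℝ (v q.1) (v q.2)

/-! ### Algebra of the sum of pairwise inner products -/

section PairInner

variable {E : Type*} [NormedAddCommGroup E] [InnerProductSpace ℝ E]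

theorem pairInner_zero (v : Fin 0 → E) : pairInner v = 0 := by
  simp [pairInner]

/-- The recursion behind every moment computation: the pairs through the new entry contribute a
linear functional of it, with coefficient the sum of the other entries. -/
theorem pairInner_cons {n : ℕ} (x : E) (v : Fin n → E) :
    pairInner (Fin.cons x v : Fin (n + 1) → E) = inner ℝ x (∑ i, v i) + pairInner v := by
  simp only [pairInner, Finset.sum_filter, Fintype.sum_prod_type, Fin.sum_univ_succ,
    Fin.cons_zero, Fin.cons_succ, inner_sum]
  simp [Fin.succ_pos]

theorem pairInner_eq_tail {n : ℕ} (v : Fin (n + 1) → E) :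
    pairInner v = inner ℝ (v 0) (∑ i : Fin n, v i.succ) + pairInner fun i : Fin n => v i.succ := by
  conv_lhs => rw [← Fin.cons_self_tail v]
  exact pairInner_cons _ _

theorem measurable_pairInner [MeasurableSpace E] [BorelSpace E] [SecondCountableTopology E]
    {n : ℕ} : Measurable (pairInner : (Fin n → E) → ℝ) := by
  unfold pairInner
  fun_prop

end PairInner

/-- A law with mean `0`, variance `1` and fourth moment at most `C`. -/
structure Standardized (C : ℝ) (ν : Measure ℝ) : Prop where
  prob : IsProbabilityMeasure ν
  memLp : MemLp id 4 ν
  mean : ∫ x, x ∂ν = 0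
  second : ∫ x, x ^ 2 ∂ν = 1
  fourth : ∫ x, x ^ 4 ∂ν ≤ C

/-! ### Fourth moments and affine images of standardized variables -/

section FourthMoment

variable {Ω : Type*} [MeasurableSpace Ω] {μ : Measure Ω}

theorem memLp_four_of_lintegral {f : Ω → ℝ} (hf : Measurable f) {B : ℝ}
    (h : ∫⁻ x, ENNReal.ofReal (f x ^ 4) ∂μ ≤ ENNReal.ofReal B) : MemLp f 4 μ := by
  have hi : Integrable (fun x => f x ^ 4) μ := by
    refine ⟨by fun_prop, ?_⟩
    rw [hasFiniteIntegral_iff_ofReal (ae_of_all _ fun x => by positivity)]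
    exact h.trans_lt ENNReal.ofReal_lt_top
  refine (integrable_norm_rpow_iff hf.aestronglyMeasurable (by norm_num) (by norm_num)).1 ?_
  refine hi.congr (ae_of_all _ fun x => ?_)
  simp only [ENNReal.toReal_ofNat, Real.norm_eq_abs]
  rw [show (4 : ℝ) = ((4 : ℕ) : ℝ) by norm_num, Real.rpow_natCast,
    Even.pow_abs (by decide : Even 4)]

theorem _root_.MeasureTheory.MemLp.integrable_pow_of_le_four [IsProbabilityMeasure μ] {f : Ω → ℝ} (hf : MemLp f 4 μ)
    {k : ℕ} (hk : k ≤ 4) : Integrable (fun x => f x ^ k) μ := by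
  have h : MemLp f k μ := hf.mono_exponent (by exact_mod_cast hk)
  have := h.integrable_norm_pow'
  refine (integrable_norm_iff (hf.1.pow k)).1 ?_
  simpa [norm_pow] using this

end FourthMoment

namespace Standardized

variable {C : ℝ} {ν : Measure ℝ}

theorem integrable_pow (h : Standardized C ν) {k : ℕ} (hk : k ≤ 4) :
    Integrable (fun x : ℝ => x ^ k) ν := by
  have := h.prob
  exact MemLp.integrable_pow_of_le_four h.memLp hk

theorem integrable_id (h : Standardized C ν) : Integrable (fun x : ℝ => x) ν := by
  simpa using h.integrable_pow (k := 1) (by norm_num)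

theorem one_le (h : Standardized C ν) : 1 ≤ C := by
  have := h.prob
  have h2 := h.integrable_pow (k := 2) (by norm_num)
  have h4 := h.integrable_pow (k := 4) (by norm_num)
  have : ∫ x, (2 * x ^ 2 - 1) ∂ν ≤ ∫ x, x ^ 4 ∂ν :=
    integral_mono ((h2.const_mul 2).sub (integrable_const _)) h4
      fun x => by nlinarith [sq_nonneg (x ^ 2 - 1)]
  rw [integral_sub (h2.const_mul 2) (integrable_const _), integral_const_mul, h.second] at this
  simp at this
  linarith [h.fourth]

theorem integral_affine (h : Standardized C ν) (T S : ℝ) : ∫ x, (x * S + T) ∂ν = T := by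
  have := h.prob
  rw [integral_add (h.integrable_id.mul_const _) (integrable_const _), integral_mul_const, h.mean]
  simp

theorem integrable_affine_sq (h : Standardized C ν) (T S : ℝ) :
    Integrable (fun x => (x * S + T) ^ 2) ν := by
  have := h.prob
  have h2 := h.integrable_pow (k := 2) (by norm_num)
  have : (fun x : ℝ => (x * S + T) ^ 2) = fun x => x ^ 2 * S ^ 2 + (x * (2 * S * T) + T ^ 2) := by
    ext; ring
  rw [this]
  exact (h2.mul_const _).add ((h.integrable_id.mul_const _).add (integrable_const _))

theorem integral_affine_sq (h : Standardized C ν) (T S : ℝ) :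
    ∫ x, (x * S + T) ^ 2 ∂ν = S ^ 2 + T ^ 2 := by
  have := h.prob
  have h2 := h.integrable_pow (k := 2) (by norm_num)
  have : (fun x : ℝ => (x * S + T) ^ 2) = fun x => x ^ 2 * S ^ 2 + (x * (2 * S * T) + T ^ 2) := by
    ext; ring
  have hi : Integrable (fun x => x * (2 * S * T) + T ^ 2) ν :=
    (h.integrable_id.mul_const _).add (integrable_const _)
  rw [this, integral_add (h2.mul_const _) hi, integral_mul_const, h.second,
    integral_affine h]
  ring

theorem lintegral_affine_sq (h : Standardized C ν) (T S : ℝ) :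
    ∫⁻ x, ENNReal.ofReal ((x * S + T) ^ 2) ∂ν = ENNReal.ofReal (S ^ 2 + T ^ 2) := by
  rw [← ofReal_integral_eq_lintegral_ofReal (h.integrable_affine_sq T S)
    (ae_of_all _ fun x => by positivity), h.integral_affine_sq]

/-- The linear term integrates to zero. The cubic term has no useful sign and is absorbed by `4x³S³T
≤ 2x⁴S⁴ + 2x²S²T²`, which raises the coefficients `1` and `6` to `3` and `8`. -/
theorem lintegral_affine_four_le (h : Standardized C ν) (T S : ℝ) :
    ∫⁻ x, ENNReal.ofReal ((x * S + T) ^ 4) ∂ν ≤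
      ENNReal.ofReal (T ^ 4 + 8 * (T ^ 2 * S ^ 2) + 3 * C * S ^ 4) := by
  have := h.prob
  have h2 := h.integrable_pow (k := 2) (by norm_num)
  have h4 := h.integrable_pow (k := 4) (by norm_num)
  have hle : ∀ x : ℝ, (x * S + T) ^ 4 ≤
      x ^ 4 * (3 * S ^ 4) + (x ^ 2 * (8 * (T ^ 2 * S ^ 2)) + (x * (4 * S * T ^ 3) + T ^ 4)) := by
    intro x
    nlinarith [sq_nonneg (x ^ 2 * S ^ 2 - x * S * T)]
  have hi1 : Integrable (fun x => x * (4 * S * T ^ 3) + T ^ 4) ν :=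
    (h.integrable_id.mul_const _).add (integrable_const _)
  have hi2 := (h2.mul_const (8 * (T ^ 2 * S ^ 2))).add hi1
  have hi := (h4.mul_const (3 * S ^ 4)).add hi2
  calc ∫⁻ x, ENNReal.ofReal ((x * S + T) ^ 4) ∂ν
      ≤ ∫⁻ x, ENNReal.ofReal (x ^ 4 * (3 * S ^ 4) +
        (x ^ 2 * (8 * (T ^ 2 * S ^ 2)) + (x * (4 * S * T ^ 3) + T ^ 4))) ∂ν :=
        lintegral_mono fun x => ENNReal.ofReal_le_ofReal (hle x)
    _ = ENNReal.ofReal (∫ x, (x ^ 4 * (3 * S ^ 4) +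
        (x ^ 2 * (8 * (T ^ 2 * S ^ 2)) + (x * (4 * S * T ^ 3) + T ^ 4))) ∂ν) :=
        (ofReal_integral_eq_lintegral_ofReal hi
          (ae_of_all _ fun x => le_trans (by positivity) (hle x))).symm
    _ ≤ _ := by
        refine ENNReal.ofReal_le_ofReal ?_
        erw [integral_add (h4.mul_const (3 * S ^ 4)) hi2,
          integral_add (h2.mul_const (8 * (T ^ 2 * S ^ 2))) hi1]
        rw [integral_mul_const, integral_mul_const, h.second, h.integral_affine]
        nlinarith [mul_le_mul_of_nonneg_right h.fourth (by positivity : 0 ≤ 3 * S ^ 4)]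

end Standardized

/-! ### Moments of linear and quadratic forms in independent variables -/

section WeightedSums

variable {C : ℝ}

theorem lintegral_weightedSum_sq_le {n : ℕ} (ν : Fin n → Measure ℝ)
    (hν : ∀ i, Standardized C (ν i)) (w : Fin n → ℝ) :
    ∫⁻ x, ENNReal.ofReal ((∑ i, w i * x i) ^ 2) ∂(Measure.pi ν) ≤
      ENNReal.ofReal (∑ i, w i ^ 2) := by
  induction n with
  | zero => simp
  | succ n ih =>
    have hp := fun i => (hν i).prob
    have hp' : ∀ i : Fin n, IsProbabilityMeasure (ν i.succ) := fun i => hp _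
    rw [lintegral_pi_succ ν (by fun_prop)]
    calc _ = ∫⁻ y : Fin n → ℝ, (ENNReal.ofReal (w 0 ^ 2) +
            ENNReal.ofReal ((∑ i : Fin n, w i.succ * y i) ^ 2))
            ∂(Measure.pi fun i : Fin n => ν i.succ) := by
          refine lintegral_congr fun y => ?_
          rw [← ENNReal.ofReal_add (by positivity) (by positivity),
            ← (hν 0).lintegral_affine_sq]
          refine lintegral_congr fun x => ?_
          simp [Fin.sum_univ_succ, mul_comm]
      _ ≤ ENNReal.ofReal (w 0 ^ 2) + ENNReal.ofReal (∑ i : Fin n, w i.succ ^ 2) := by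
          rw [lintegral_add_left (by fun_prop), lintegral_const, measure_univ, mul_one]
          gcongr
          exact ih (fun i => ν i.succ) (fun i => hν _) _
      _ = _ := by
          rw [← ENNReal.ofReal_add (by positivity) (by positivity), Fin.sum_univ_succ]

/-- The induction step needs `4Cs² + 8w₀²s + 3Cw₀⁴ ≤ 4C(s + w₀²)²`, whose cross term is where `1 ≤
C` enters. -/
theorem lintegral_weightedSum_four_le (hC : 1 ≤ C) {n : ℕ} (ν : Fin n → Measure ℝ)
    (hν : ∀ i, Standardized C (ν i)) (w : Fin n → ℝ) :
    ∫⁻ x, ENNReal.ofReal ((∑ i, w i * x i) ^ 4) ∂(Measure.pi ν) ≤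
      ENNReal.ofReal (4 * C * (∑ i, w i ^ 2) ^ 2) := by
  induction n with
  | zero => simp
  | succ n ih =>
    have hp := fun i => (hν i).prob
    have hp' : ∀ i : Fin n, IsProbabilityMeasure (ν i.succ) := fun i => hp _
    rw [lintegral_pi_succ ν (by fun_prop)]
    have ih' := ih (fun i => ν i.succ) (fun i => hν _) (fun i => w i.succ)
    have h2 := lintegral_weightedSum_sq_le (fun i => ν i.succ) (fun i => hν _) (fun i => w i.succ)
    set s := ∑ i : Fin n, w i.succ ^ 2
    have hs : 0 ≤ s := by positivity
    calc _ ≤ ∫⁻ y : Fin n → ℝ, (ENNReal.ofReal ((∑ i : Fin n, w i.succ * y i) ^ 4) +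
            (ENNReal.ofReal (8 * w 0 ^ 2) * ENNReal.ofReal ((∑ i : Fin n, w i.succ * y i) ^ 2) +
            ENNReal.ofReal (3 * C * w 0 ^ 4)))
            ∂(Measure.pi fun i : Fin n => ν i.succ) := by
          refine lintegral_mono fun y => ?_
          rw [← ENNReal.ofReal_mul (by positivity), ← ENNReal.ofReal_add (by positivity)
            (by positivity), ← ENNReal.ofReal_add (by positivity) (by positivity)]
          refine le_trans (le_of_eq ?_) (((hν 0).lintegral_affine_four_le
            (∑ i : Fin n, w i.succ * y i) (w 0)).trans (ENNReal.ofReal_le_ofReal (by nlinarith)))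
          refine lintegral_congr fun x => ?_
          simp [Fin.sum_univ_succ, mul_comm]
      _ ≤ ENNReal.ofReal (4 * C * s ^ 2) + (ENNReal.ofReal (8 * w 0 ^ 2) * ENNReal.ofReal s +
            ENNReal.ofReal (3 * C * w 0 ^ 4)) := by
          rw [lintegral_add_left (by fun_prop), lintegral_add_left (by fun_prop),
            lintegral_const_mul _ (by fun_prop), lintegral_const, measure_univ, mul_one]
          gcongr
      _ ≤ _ := by
          rw [← ENNReal.ofReal_mul (by positivity), ← ENNReal.ofReal_add (by positivity)
            (by positivity), ← ENNReal.ofReal_add (by positivity) (by positivity),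
            Fin.sum_univ_succ]
          refine ENNReal.ofReal_le_ofReal ?_
          have : 0 ≤ (C - 1) * (w 0 ^ 2 * s) := mul_nonneg (by linarith) (by positivity)
          have : 0 ≤ C * w 0 ^ 4 := by positivity
          nlinarith

/-- The fourth moment of the decoupled quadratic form `∑_{i < k} w i * w k * x i * x k`. -/
theorem lintegral_pairInner_four_le (hC : 1 ≤ C) {n : ℕ} (ν : Fin n → Measure ℝ)
    (hν : ∀ i, Standardized C (ν i)) (w : Fin n → ℝ) :
    ∫⁻ x, ENNReal.ofReal (pairInner (fun i => w i * x i) ^ 4) ∂(Measure.pi ν) ≤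
      ENNReal.ofReal (16 * C ^ 2 * (∑ i, w i ^ 2) ^ 4) := by
  induction n with
  | zero => simp [pairInner_zero]
  | succ n ih =>
    have hp := fun i => (hν i).prob
    have hp' : ∀ i : Fin n, IsProbabilityMeasure (ν i.succ) := fun i => hp _
    have hm : ∀ m : ℕ, ∀ v : Fin m → ℝ,
      Measurable fun x : Fin m → ℝ => pairInner (fun i => v i * x i) := fun m v =>
      measurable_pairInner.comp (by fun_prop)
    have hm1 := hm (n + 1) w
    have hm2 := hm n fun i => w i.succ
    rw [lintegral_pi_succ ν (by fun_prop)]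
    have ih' := ih (fun i => ν i.succ) (fun i => hν _) (fun i => w i.succ)
    have h4 := lintegral_weightedSum_four_le hC (fun i => ν i.succ) (fun i => hν _)
      (fun i => w i.succ)
    set s := ∑ i : Fin n, w i.succ ^ 2 with hsdef
    have hs : 0 ≤ s := by positivity
    -- Young's inequality, weighted by `s⁻¹` and `s` because the fourth moments of the form and of
    -- the sum scale like `s⁴` and `s²`. Each side then contributes at most `32 C² w₀² s³`, together
    -- the cross term of `16 C² (w₀² + s)⁴`. If `s = 0`, all later weights vanish.
    have key : ∀ y : Fin n → ℝ,
        8 * (pairInner (fun i : Fin n => w i.succ * y i) ^ 2 *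
          (w 0 * ∑ i : Fin n, w i.succ * y i) ^ 2) ≤
        2 * w 0 ^ 2 * s⁻¹ * pairInner (fun i : Fin n => w i.succ * y i) ^ 4 +
          8 * w 0 ^ 2 * s * (∑ i : Fin n, w i.succ * y i) ^ 4 := by
      intro y
      rcases hs.eq_or_lt with h0 | hpos
      · have hz : ∀ i : Fin n, w i.succ = 0 := by
          intro i
          have := (Finset.sum_eq_zero_iff_of_nonneg (fun i _ => sq_nonneg (w (Fin.succ i)))).1
            (hsdef ▸ h0.symm) i (Finset.mem_univ i)
          simpa using this
        simp only [hz, zero_mul, Finset.sum_const_zero, mul_zero, ne_eq, OfNat.ofNat_ne_zero,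
          not_false_eq_true, zero_pow]
        positivity
      · set T := pairInner (fun i : Fin n => w i.succ * y i)
        set S := ∑ i : Fin n, w i.succ * y i
        have : 2 * w 0 ^ 2 * s⁻¹ * T ^ 4 + 8 * w 0 ^ 2 * s * S ^ 4 -
            8 * (T ^ 2 * (w 0 * S) ^ 2) = 2 * w 0 ^ 2 * s⁻¹ * (T ^ 2 - 2 * s * S ^ 2) ^ 2 := by
          field_simp
          ring
        have h0 : 0 ≤ 2 * w 0 ^ 2 * s⁻¹ * (T ^ 2 - 2 * s * S ^ 2) ^ 2 := by positivity
        linarith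
    calc _ ≤ ∫⁻ y : Fin n → ℝ, (ENNReal.ofReal (1 + 2 * w 0 ^ 2 * s⁻¹) *
              ENNReal.ofReal (pairInner (fun i : Fin n => w i.succ * y i) ^ 4) +
            ENNReal.ofReal (8 * w 0 ^ 2 * s + 3 * C * w 0 ^ 4) *
              ENNReal.ofReal ((∑ i : Fin n, w i.succ * y i) ^ 4))
            ∂(Measure.pi fun i : Fin n => ν i.succ) := by
          refine lintegral_mono fun y => ?_
          rw [← ENNReal.ofReal_mul (by positivity), ← ENNReal.ofReal_mul (by positivity),
            ← ENNReal.ofReal_add (by positivity) (by positivity)]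
          refine le_trans (le_of_eq ?_) (((hν 0).lintegral_affine_four_le
            (pairInner (fun i : Fin n => w i.succ * y i))
            (w 0 * ∑ i : Fin n, w i.succ * y i)).trans
              (ENNReal.ofReal_le_ofReal (by linarith [key y])))
          refine lintegral_congr fun x => ?_
          rw [pairInner_eq_tail]
          simp only [Fin.cons_zero, Fin.cons_succ, Real.inner_apply]
          ring_nf
      _ ≤ ENNReal.ofReal (1 + 2 * w 0 ^ 2 * s⁻¹) * ENNReal.ofReal (16 * C ^ 2 * s ^ 4) +
            ENNReal.ofReal (8 * w 0 ^ 2 * s + 3 * C * w 0 ^ 4) *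
              ENNReal.ofReal (4 * C * s ^ 2) := by
          rw [lintegral_add_left (by fun_prop), lintegral_const_mul _ (by fun_prop),
            lintegral_const_mul _ (by fun_prop)]
          gcongr
      _ ≤ _ := by
          rw [← ENNReal.ofReal_mul (by positivity), ← ENNReal.ofReal_mul (by positivity),
            ← ENNReal.ofReal_add (by positivity) (by positivity), Fin.sum_univ_succ]
          refine ENNReal.ofReal_le_ofReal ?_
          have e : (1 + 2 * w 0 ^ 2 * s⁻¹) * (16 * C ^ 2 * s ^ 4) =
              16 * C ^ 2 * s ^ 4 + 32 * C ^ 2 * w 0 ^ 2 * s ^ 3 := by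
            rcases hs.eq_or_lt with h0 | hpos
            · simp [← h0]
            · field_simp
              ring
          rw [e]
          change _ ≤ 16 * C ^ 2 * (w 0 ^ 2 + s) ^ 4
          have a1 : 0 ≤ (C - 1) * (C * (w 0 ^ 2 * s ^ 3)) :=
            mul_nonneg (by linarith) (by positivity)
          have a2 : 0 ≤ C ^ 2 * w 0 ^ 4 * s ^ 2 := by positivity
          have a3 : 0 ≤ C ^ 2 * (w 0 ^ 2) ^ 3 * s := by positivity
          have a4 : 0 ≤ C ^ 2 * (w 0 ^ 2) ^ 4 := by positivity
          nlinarith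

theorem memLp_weightedSum {n : ℕ} (ν : Fin n → Measure ℝ)
    (hν : ∀ i, Standardized C (ν i)) (w : Fin n → ℝ) :
    MemLp (fun x : Fin n → ℝ => ∑ i, w i * x i) 4 (Measure.pi ν) := by
  -- `1 ≤ C` is read off a marginal, so the empty index set is treated apart.
  rcases n.eq_zero_or_pos with rfl | hn
  · simp
  · exact memLp_four_of_lintegral (by fun_prop)
      (lintegral_weightedSum_four_le (hν ⟨0, hn⟩).one_le ν hν w)

theorem integral_weightedSum_sq {n : ℕ} (ν : Fin n → Measure ℝ)
    (hν : ∀ i, Standardized C (ν i)) (w : Fin n → ℝ) :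
    ∫ x, (∑ i, w i * x i) ^ 2 ∂(Measure.pi ν) = ∑ i, w i ^ 2 := by
  induction n with
  | zero => simp
  | succ n ih =>
    have hp := fun i => (hν i).prob
    have hp' : ∀ i : Fin n, IsProbabilityMeasure (ν i.succ) := fun i => hp _
    rw [integral_pi_succ ν (by fun_prop)
      ((memLp_weightedSum ν hν w).integrable_pow_of_le_four (by norm_num))]
    have hi : Integrable (fun y : Fin n → ℝ => (∑ i : Fin n, w i.succ * y i) ^ 2)
        (Measure.pi fun i : Fin n => ν i.succ) :=
      (memLp_weightedSum _ (fun i => hν _) _).integrable_pow_of_le_four (by norm_num)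
    calc _ = ∫ y : Fin n → ℝ, (w 0 ^ 2 + (∑ i : Fin n, w i.succ * y i) ^ 2)
            ∂(Measure.pi fun i : Fin n => ν i.succ) := by
          refine integral_congr_ae (ae_of_all _ fun y => ?_)
          change _ = w 0 ^ 2 + (∑ i : Fin n, w i.succ * y i) ^ 2
          rw [← (hν 0).integral_affine_sq]
          simp [Fin.sum_univ_succ, mul_comm]
      _ = _ := by
          rw [integral_add (integrable_const _) hi, ih (fun i => ν i.succ) (fun i => hν _),
            Fin.sum_univ_succ]
          simp

theorem memLp_pairInner {n : ℕ} (ν : Fin n → Measure ℝ)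
    (hν : ∀ i, Standardized C (ν i)) (w : Fin n → ℝ) :
    MemLp (fun x : Fin n → ℝ => pairInner fun i => w i * x i) 4 (Measure.pi ν) := by
  rcases n.eq_zero_or_pos with rfl | hn
  · simp [pairInner_zero]
  · exact memLp_four_of_lintegral (measurable_pairInner.comp (by fun_prop))
      (lintegral_pairInner_four_le (hν ⟨0, hn⟩).one_le ν hν w)

theorem integral_pairInner {n : ℕ} (ν : Fin n → Measure ℝ)
    (hν : ∀ i, Standardized C (ν i)) (w : Fin n → ℝ) :
    ∫ x, pairInner (fun i => w i * x i) ∂(Measure.pi ν) = 0 := by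
  induction n with
  | zero => simp [pairInner_zero]
  | succ n ih =>
    have hp := fun i => (hν i).prob
    have hp' : ∀ i : Fin n, IsProbabilityMeasure (ν i.succ) := fun i => hp _
    have hm1 : Measurable fun x : Fin (n + 1) → ℝ => pairInner fun i => w i * x i :=
      measurable_pairInner.comp (by fun_prop)
    rw [integral_pi_succ ν hm1 ((memLp_pairInner ν hν w).integrable (by norm_num)),
      ← ih (fun i => ν i.succ) (fun i => hν _) (fun i => w i.succ)]
    refine integral_congr_ae (ae_of_all _ fun y => ?_)
    dsimp only
    rw [← (hν 0).integral_affine (pairInner fun i : Fin n => w i.succ * y i)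
      (w 0 * ∑ i : Fin n, w i.succ * y i)]
    refine integral_congr_ae (ae_of_all _ fun x => ?_)
    dsimp only
    rw [pairInner_eq_tail]
    simp only [Fin.cons_zero, Fin.cons_succ, Real.inner_apply]
    ring

/-- The products `x i * x k` over distinct pairs are orthonormal, so only the squared coefficients
survive; they form the same pair sum in the squared weights. -/
theorem integral_pairInner_sq {n : ℕ} (ν : Fin n → Measure ℝ)
    (hν : ∀ i, Standardized C (ν i)) (w : Fin n → ℝ) :
    ∫ x, pairInner (fun i => w i * x i) ^ 2 ∂(Measure.pi ν) = pairInner fun i => w i ^ 2 := by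
  induction n with
  | zero => simp [pairInner_zero]
  | succ n ih =>
    have hp := fun i => (hν i).prob
    have hp' : ∀ i : Fin n, IsProbabilityMeasure (ν i.succ) := fun i => hp _
    have hm1 : Measurable fun x : Fin (n + 1) → ℝ => pairInner fun i => w i * x i :=
      measurable_pairInner.comp (by fun_prop)
    rw [integral_pi_succ ν (by fun_prop)
      ((memLp_pairInner ν hν w).integrable_pow_of_le_four (by norm_num))]
    have hi : Integrable (fun y : Fin n → ℝ => (∑ i : Fin n, w i.succ * y i) ^ 2)
        (Measure.pi fun i : Fin n => ν i.succ) :=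
      (memLp_weightedSum _ (fun i => hν _) _).integrable_pow_of_le_four (by norm_num)
    have hi' : Integrable (fun y : Fin n → ℝ => pairInner (fun i : Fin n => w i.succ * y i) ^ 2)
        (Measure.pi fun i : Fin n => ν i.succ) :=
      (memLp_pairInner _ (fun i => hν _) _).integrable_pow_of_le_four (by norm_num)
    calc _ = ∫ y : Fin n → ℝ, (w 0 ^ 2 * (∑ i : Fin n, w i.succ * y i) ^ 2 +
            pairInner (fun i : Fin n => w i.succ * y i) ^ 2)
            ∂(Measure.pi fun i : Fin n => ν i.succ) := by
          refine integral_congr_ae (ae_of_all _ fun y => ?_)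
          dsimp only
          rw [← mul_pow, ← (hν 0).integral_affine_sq]
          refine integral_congr_ae (ae_of_all _ fun x => ?_)
          dsimp only
          rw [pairInner_eq_tail]
          simp only [Fin.cons_zero, Fin.cons_succ, Real.inner_apply]
          ring
      _ = _ := by
          rw [integral_add (hi.const_mul _) hi', integral_const_mul,
            integral_weightedSum_sq _ fun i => hν _, ih (fun i => ν i.succ) (fun i => hν _),
            pairInner_eq_tail]
          simp only [Real.inner_apply]

end WeightedSums

/-! ### Second moment of the U-statistic with inner product kernel -/

section UStatistic

variable {E : Type*} [NormedAddCommGroup E] [InnerProductSpace ℝ E]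

/-- Hoeffding decomposition: mean, linear projection, and degenerate part. -/
theorem pairInner_eq_centered {n : ℕ} (θ : E) (u : Fin n → E) :
    pairInner u = (n : ℝ) * (n - 1) / 2 * ‖θ‖ ^ 2 + (n - 1) * inner ℝ (∑ i, (u i - θ)) θ +
      pairInner fun i => u i - θ := by
  induction n with
  | zero => simp [pairInner_zero]
  | succ n ih =>
    have hs : ∑ i : Fin n, u i.succ = ∑ i : Fin n, (u i.succ - θ) + (n : ℝ) • θ := by
      simp [Finset.sum_sub_distrib, Nat.cast_smul_eq_nsmul]
    rw [pairInner_eq_tail, pairInner_eq_tail (fun i => u i - θ), ih, hs, Fin.sum_univ_succ]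
    obtain ⟨c, hc⟩ : ∃ c, c = u 0 - θ := ⟨_, rfl⟩
    rw [← hc, show u 0 = c + θ by rw [hc]; abel]
    generalize ∑ i : Fin n, (u i.succ - θ) = s
    simp only [inner_add_left, inner_add_right, inner_smul_right, real_inner_self_eq_norm_sq,
      real_inner_comm s θ]
    push_cast
    ring

variable [MeasurableSpace E]

/-- A law on `E` with mean `θ` and second moment form bounded by `lam * ‖v‖ ^ 2`. -/
structure SecondMomentBound (θ : E) (lam : ℝ) (τ : Measure E) : Prop where
  prob : IsProbabilityMeasure τ
  memLp : ∀ v, MemLp (fun u => inner ℝ u v) 2 τ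
  mean : ∀ v, ∫ u, inner ℝ u v ∂τ = inner ℝ θ v
  second : ∀ v, ∫ u, (inner ℝ u v) ^ 2 ∂τ ≤ lam * ‖v‖ ^ 2

variable {θ : E} {lam : ℝ} {τ : Measure E}

/-- Centering at the mean kills the cross term and subtracts `⟨θ, v⟩²` from the second moment; that
gain is discarded. -/
theorem SecondMomentBound.lintegral_affine_sq_le (h : SecondMomentBound θ lam τ) (v : E) (T : ℝ) :
    ∫⁻ u, ENNReal.ofReal ((inner ℝ (u - θ) v + T) ^ 2) ∂τ ≤
      ENNReal.ofReal (lam * ‖v‖ ^ 2 + T ^ 2) := by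
  have := h.prob
  have h1 : Integrable (fun u => inner ℝ u v) τ := (h.memLp v).integrable (by norm_num)
  have h2 : Integrable (fun u => (inner ℝ u v) ^ 2) τ := (h.memLp v).integrable_sq
  have e : (fun u => (inner ℝ (u - θ) v + T) ^ 2) = fun u => (inner ℝ u v) ^ 2 +
      (inner ℝ u v * (2 * (T - inner ℝ θ v)) + (T - inner ℝ θ v) ^ 2) := by
    ext u
    rw [inner_sub_left]
    ring
  have hi1 : Integrable (fun u => inner ℝ u v * (2 * (T - inner ℝ θ v)) +
      (T - inner ℝ θ v) ^ 2) τ := (h1.mul_const _).add (integrable_const _)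
  rw [← ofReal_integral_eq_lintegral_ofReal (by rw [e]; exact h2.add hi1)
    (ae_of_all _ fun x => by positivity)]
  refine ENNReal.ofReal_le_ofReal ?_
  rw [e, integral_add h2 hi1, integral_add (h1.mul_const _) (integrable_const _),
    integral_mul_const, h.mean]
  simp only [integral_const, probReal_univ, smul_eq_mul, one_mul]
  nlinarith [h.second v, sq_nonneg (inner ℝ θ v)]

variable [BorelSpace E] [FiniteDimensional ℝ E]

theorem SecondMomentBound.lintegral_inner_sum_sq_le (h : SecondMomentBound θ lam τ)
    (hlam : 0 ≤ lam) (n : ℕ) (v : E) :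
    ∫⁻ u, ENNReal.ofReal ((inner ℝ (∑ i, (u i - θ)) v) ^ 2) ∂(Measure.pi fun _ : Fin n => τ) ≤
      ENNReal.ofReal (n * (lam * ‖v‖ ^ 2)) := by
  have := h.prob
  induction n with
  | zero => simp
  | succ n ih =>
    rw [lintegral_pi_succ _ (by fun_prop)]
    calc _ ≤ ∫⁻ y : Fin n → E, (ENNReal.ofReal (lam * ‖v‖ ^ 2) +
            ENNReal.ofReal ((inner ℝ (∑ i, (y i - θ)) v) ^ 2))
            ∂(Measure.pi fun _ : Fin n => τ) := by
          refine lintegral_mono fun y => ?_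
          rw [← ENNReal.ofReal_add (by positivity) (by positivity)]
          refine le_trans (le_of_eq ?_) (h.lintegral_affine_sq_le _ _)
          refine lintegral_congr fun x => ?_
          rw [Fin.sum_univ_succ, inner_add_left]
          rfl
      _ ≤ ENNReal.ofReal (lam * ‖v‖ ^ 2) + ENNReal.ofReal (n * (lam * ‖v‖ ^ 2)) := by
          rw [lintegral_add_left (by fun_prop), lintegral_const, measure_univ, mul_one]
          gcongr
      _ = _ := by
          rw [← ENNReal.ofReal_add (by positivity) (by positivity)]
          congr 1
          push_cast
          ring

/-- Parseval in an orthonormal basis: each direction contributes `n * lam`, whence the dimension. -/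
theorem SecondMomentBound.lintegral_norm_sum_sq_le (h : SecondMomentBound θ lam τ)
    (hlam : 0 ≤ lam) (n : ℕ) :
    ∫⁻ u, ENNReal.ofReal (‖∑ i, (u i - θ)‖ ^ 2) ∂(Measure.pi fun _ : Fin n => τ) ≤
      ENNReal.ofReal (n * (lam * Module.finrank ℝ E)) := by
  have := h.prob
  let b := stdOrthonormalBasis ℝ E
  have e : ∀ x : E, ENNReal.ofReal (‖x‖ ^ 2) = ∑ j, ENNReal.ofReal ((inner ℝ x (b j)) ^ 2) := by
    intro x
    rw [← ENNReal.ofReal_sum_of_nonneg fun j _ => sq_nonneg _, ← b.sum_sq_norm_inner_left x]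
    simp
  simp_rw [e]
  rw [lintegral_finsetSum _ fun j _ => by fun_prop]
  calc _ ≤ ∑ j, ENNReal.ofReal (n * (lam * ‖b j‖ ^ 2)) :=
        Finset.sum_le_sum fun j _ => h.lintegral_inner_sum_sq_le hlam n (b j)
    _ = _ := by
        rw [← ENNReal.ofReal_sum_of_nonneg fun j _ => by positivity]
        congr 1
        simp
        ring

/-- Given the other entries, the new one adds a centered term with second moment at most `lam * ‖∑
(y i - θ)‖²`, on average at most `n * lam² * dim`. The increments sum to less than `n² * lam² *
dim`. -/
theorem SecondMomentBound.lintegral_pairInner_centered_sq_le (h : SecondMomentBound θ lam τ)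
    (hlam : 0 ≤ lam) (n : ℕ) :
    ∫⁻ u, ENNReal.ofReal ((pairInner fun i => u i - θ) ^ 2) ∂(Measure.pi fun _ : Fin n => τ) ≤
      ENNReal.ofReal (n ^ 2 * (lam ^ 2 * Module.finrank ℝ E)) := by
  have := h.prob
  induction n with
  | zero => simp [pairInner_zero]
  | succ n ih =>
    have hm : ∀ m : ℕ, Measurable fun u : Fin m → E => pairInner fun i => u i - θ :=
      fun m => measurable_pairInner.comp (by fun_prop)
    have hm1 := hm (n + 1)
    have hm2 := hm n
    rw [lintegral_pi_succ _ (by fun_prop)]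
    calc _ ≤ ∫⁻ y : Fin n → E, (ENNReal.ofReal lam * ENNReal.ofReal (‖∑ i, (y i - θ)‖ ^ 2) +
            ENNReal.ofReal ((pairInner fun i => y i - θ) ^ 2))
            ∂(Measure.pi fun _ : Fin n => τ) := by
          refine lintegral_mono fun y => ?_
          rw [← ENNReal.ofReal_mul hlam, ← ENNReal.ofReal_add (by positivity) (by positivity)]
          refine le_trans (le_of_eq ?_) (h.lintegral_affine_sq_le _ _)
          refine lintegral_congr fun x => ?_
          rw [pairInner_eq_tail]
          simp
      _ ≤ ENNReal.ofReal lam * ENNReal.ofReal (n * (lam * Module.finrank ℝ E)) +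
            ENNReal.ofReal (n ^ 2 * (lam ^ 2 * Module.finrank ℝ E)) := by
          rw [lintegral_add_left (by fun_prop), lintegral_const_mul _ (by fun_prop)]
          gcongr
          exact h.lintegral_norm_sum_sq_le hlam n
      _ ≤ _ := by
          rw [← ENNReal.ofReal_mul hlam, ← ENNReal.ofReal_add (by positivity) (by positivity)]
          refine ENNReal.ofReal_le_ofReal ?_
          push_cast
          have : 0 ≤ lam ^ 2 * (Module.finrank ℝ E : ℝ) := by positivity
          nlinarith [mul_nonneg (Nat.cast_nonneg (α := ℝ) n) this]

theorem SecondMomentBound.lintegral_pairInner_sub_sq_le (h : SecondMomentBound θ lam τ)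
    (hlam : 0 ≤ lam) (n : ℕ) :
    ∫⁻ u, ENNReal.ofReal ((pairInner u - (n : ℝ) * (n - 1) / 2 * ‖θ‖ ^ 2) ^ 2)
        ∂(Measure.pi fun _ : Fin n => τ) ≤
      ENNReal.ofReal (2 * n ^ 3 * (lam * ‖θ‖ ^ 2) +
        2 * n ^ 2 * (lam ^ 2 * Module.finrank ℝ E)) := by
  have := h.prob
  rcases n.eq_zero_or_pos with rfl | hn
  · simp [pairInner_zero]
  have hn1 : (1 : ℝ) ≤ n := by exact_mod_cast hn
  have hm : Measurable fun u : Fin n → E => pairInner fun i => u i - θ :=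
    measurable_pairInner.comp (by fun_prop)
  calc _ ≤ ∫⁻ u : Fin n → E, (ENNReal.ofReal (2 * ((n : ℝ) - 1) ^ 2) *
          ENNReal.ofReal ((inner ℝ (∑ i, (u i - θ)) θ) ^ 2) +
          ENNReal.ofReal 2 * ENNReal.ofReal ((pairInner fun i => u i - θ) ^ 2))
          ∂(Measure.pi fun _ : Fin n => τ) := by
        refine lintegral_mono fun u => ?_
        rw [← ENNReal.ofReal_mul (by positivity), ← ENNReal.ofReal_mul (by positivity),
          ← ENNReal.ofReal_add (by positivity) (by positivity)]
        refine ENNReal.ofReal_le_ofReal ?_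
        rw [pairInner_eq_centered θ u]
        nlinarith [sq_nonneg (((n : ℝ) - 1) * inner ℝ (∑ i, (u i - θ)) θ -
          pairInner fun i => u i - θ)]
    _ ≤ ENNReal.ofReal (2 * ((n : ℝ) - 1) ^ 2) * ENNReal.ofReal (n * (lam * ‖θ‖ ^ 2)) +
          ENNReal.ofReal 2 * ENNReal.ofReal (n ^ 2 * (lam ^ 2 * Module.finrank ℝ E)) := by
        rw [lintegral_add_left (by fun_prop), lintegral_const_mul _ (by fun_prop),
          lintegral_const_mul _ (by fun_prop)]
        gcongr
        · exact h.lintegral_inner_sum_sq_le hlam n θ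
        · exact h.lintegral_pairInner_centered_sq_le hlam n
    _ ≤ _ := by
        rw [← ENNReal.ofReal_mul (by positivity), ← ENNReal.ofReal_mul (by positivity),
          ← ENNReal.ofReal_add (by positivity) (by positivity)]
        refine ENNReal.ofReal_le_ofReal ?_
        have h0 : 0 ≤ lam * ‖θ‖ ^ 2 := by positivity
        have h1 : 2 * ((n : ℝ) - 1) ^ 2 * n ≤ 2 * n ^ 3 := by nlinarith
        have := mul_le_mul_of_nonneg_right h1 h0
        linarith

end UStatistic

/-! ### The independent design as a product measure -/

section DesignStructure

/-- The iterated product also has independent entries with the given marginals, so both laws agree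
once flattened to `α × β`; currying back gives the claim. -/
theorem map_pi_pi_of_iIndepFun {α β Ω : Type*} [Fintype α] [Fintype β] [MeasurableSpace Ω]
    {P : Measure Ω} [IsProbabilityMeasure P] (A : α → β → Ω → ℝ)
    (hA : ∀ a b, Measurable (A a b)) (h : iIndepFun (fun q : α × β => A q.1 q.2) P) :
    P.map (fun ω a b => A a b ω) = Measure.pi fun a => Measure.pi fun b => P.map (A a b) := by
  have hp : ∀ a b, IsProbabilityMeasure (P.map (A a b)) :=
    fun a b => Measure.isProbabilityMeasure_map (hA a b).aemeasurable
  let Q : Measure (α → β → ℝ) := Measure.pi fun a => Measure.pi fun b => P.map (A a b)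
  have hrow : ∀ a, Q.map (fun X => X a) = Measure.pi fun b => P.map (A a b) := fun a =>
    (measurePreserving_eval (fun a => Measure.pi fun b => P.map (A a b)) a).map_eq
  have hentry : ∀ a b, Q.map (fun X => X a b) = P.map (A a b) := by
    intro a b
    have := (measurePreserving_eval (fun b => P.map (A a b)) b).map_eq
    rw [← hrow a, Measure.map_map (by fun_prop) (by fun_prop)] at this
    exact this
  have hQ : iIndepFun (fun (q : α × β) (X : α → β → ℝ) => X q.1 q.2) Q := by
    refine iIndepFun_uncurry' (X := fun a b (X : α → β → ℝ) => X a b) (by fun_prop) ?_ fun a => ?_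
    · exact iIndepFun_pi (X := fun _ => id) fun a => aemeasurable_id
    · rw [iIndepFun_iff_map_fun_eq_pi_map
        fun b => (by fun_prop : Measurable fun X : α → β → ℝ => X a b).aemeasurable]
      simp_rw [hentry]
      exact hrow a
  have hP := (iIndepFun_iff_map_fun_eq_pi_map (fun q : α × β => (hA q.1 q.2).aemeasurable)).1 h
  have hQ' := (iIndepFun_iff_map_fun_eq_pi_map fun q : α × β =>
    (by fun_prop : Measurable fun X : α → β → ℝ => X q.1 q.2).aemeasurable).1 hQ
  simp_rw [hentry] at hQ'
  rw [← hP] at hQ'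
  have hc : Measurable fun (x : α × β → ℝ) a b => x (a, b) := by fun_prop
  have := congrArg (Measure.map fun (x : α × β → ℝ) a b => x (a, b)) hQ'
  rw [Measure.map_map hc (by fun_prop), Measure.map_map hc (by fun_prop)] at this
  rw [show ((fun (x : α × β → ℝ) a b => x (a, b)) ∘ fun (X : α → β → ℝ) (q : α × β) => X q.1 q.2)
    = id from rfl, Measure.map_id] at this
  exact this.symm

variable {n p : ℕ} {PX : Measure (Design n p)}

theorem integrable_entry_sq (hX : IsStandardDesign PX) (i : Fin n) (j : Fin p) :
    Integrable (fun X : Design n p => X i j ^ 2) PX := by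
  by_contra h
  have := hX.second_moment_one i j
  rw [integral_undef h] at this
  norm_num at this

variable [IsProbabilityMeasure PX]

theorem one_le_lintegral_entry_four (hX : IsStandardDesign PX) (i : Fin n) (j : Fin p) :
    1 ≤ ∫⁻ X, ENNReal.ofReal (X i j ^ 4) ∂PX := by
  have h2 := integrable_entry_sq hX i j
  -- This is `2x² ≤ x⁴ + 1`, integrated in additive form so that the fourth moment may be infinite.
  have h : ENNReal.ofReal (∫ X, (X i j) ^ 2 ∂PX) + ENNReal.ofReal (∫ X, (X i j) ^ 2 ∂PX) ≤
      ∫⁻ X, ENNReal.ofReal (X i j ^ 4) ∂PX + 1 := by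
    rw [ofReal_integral_eq_lintegral_ofReal h2 (ae_of_all _ fun X => sq_nonneg _),
      ← lintegral_add_left (by fun_prop)]
    have : (1 : ENNReal) = ∫⁻ _, 1 ∂PX := by simp
    rw [this, ← lintegral_add_left (by fun_prop)]
    refine lintegral_mono fun X => ?_
    rw [← ENNReal.ofReal_one, ← ENNReal.ofReal_add (by positivity) (by positivity),
      ← ENNReal.ofReal_add (by positivity) (by positivity)]
    refine ENNReal.ofReal_le_ofReal ?_
    nlinarith [sq_nonneg (X i j ^ 2 - 1)]
  rw [hX.second_moment_one, ENNReal.ofReal_one] at h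
  exact (ENNReal.add_le_add_iff_right (by simp)).1 h

/-- Independence factors the moment of the product, and the partner's fourth moment is at least `1`.
This is how (B1) controls single entries. -/
theorem lintegral_entry_four_le_of_ne (hX : IsStandardDesign PX) (hA : IndependentDesign PX)
    (i : Fin n) {j j' : Fin p} (hj : j ≠ j') :
    ∫⁻ X, ENNReal.ofReal (X i j ^ 4) ∂PX ≤
      ∫⁻ X, ENNReal.ofReal ((X i j * X i j') ^ 4) ∂PX := by
  have hi : IndepFun (fun X : Design n p => X i j) (fun X : Design n p => X i j') PX :=
    hA.indepFun (i := (i, j)) (j := (i, j')) (by simpa using hj)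
  have hi4 : IndepFun (fun X : Design n p => ENNReal.ofReal (X i j ^ 4))
      (fun X : Design n p => ENNReal.ofReal (X i j' ^ 4)) PX :=
    hi.comp (φ := fun x : ℝ => ENNReal.ofReal (x ^ 4)) (ψ := fun x : ℝ => ENNReal.ofReal (x ^ 4))
      (by fun_prop) (by fun_prop)
  have e : ∀ X : Design n p, ENNReal.ofReal ((X i j * X i j') ^ 4) =
      ENNReal.ofReal (X i j ^ 4) * ENNReal.ofReal (X i j' ^ 4) := fun X => by
    rw [mul_pow, ENNReal.ofReal_mul (by positivity)]
  simp_rw [e]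
  have := lintegral_mul_eq_lintegral_mul_lintegral_of_indepFun (by fun_prop) (by fun_prop) hi4
  simp only [Pi.mul_apply] at this
  rw [this]
  exact le_mul_of_one_le_right' (one_le_lintegral_entry_four hX i j')

theorem lintegral_entry_four_le (hX : IsStandardDesign PX) (hA : IndependentDesign PX)
    (hp : 2 ≤ p) {C : ENNReal}
    (hC : ∀ (i : Fin n) (j j' : Fin p), j < j' →
      ∫⁻ X, ENNReal.ofReal ((X i j * X i j') ^ 4) ∂PX ≤ C) (i : Fin n) (j : Fin p) :
    ∫⁻ X, ENNReal.ofReal (X i j ^ 4) ∂PX ≤ C := by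
  have : Nontrivial (Fin p) := Fin.nontrivial_iff_two_le.2 hp
  obtain ⟨j', hj'⟩ := exists_ne j
  refine (lintegral_entry_four_le_of_ne hX hA i hj'.symm).trans ?_
  rcases lt_or_gt_of_ne hj' with h | h
  · simpa [mul_comm] using hC i j' j h
  · exact hC i j j' h

/-- Both product structures are needed: i.i.d. rows for the type II bound, independent columns for
the type I limit. -/
theorem exists_standardized_marginals (hX : IsStandardDesign PX) (hA : IndependentDesign PX)
    (hn : 0 < n) (hp : 2 ≤ p) {C : NNReal}
    (hC : ∀ (i : Fin n) (j j' : Fin p), j < j' →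
      ∫⁻ X, ENNReal.ofReal ((X i j * X i j') ^ 4) ∂PX ≤ C) :
    ∃ ν : Fin p → Measure ℝ, (∀ j, Standardized C (ν j)) ∧
      PX = Measure.pi (fun _ : Fin n => Measure.pi ν) ∧
      PX.map (fun X j i => X i j) = Measure.pi fun j => Measure.pi fun _ : Fin n => ν j := by
  let i0 : Fin n := ⟨0, hn⟩
  have hmap : ∀ i j, PX.map (fun X => X i j) = PX.map (fun X => X i0 j) := fun i j =>
    (hX.identDistrib j i i0).map_eq
  refine ⟨fun j => PX.map (fun X => X i0 j), fun j => ?_, ?_, ?_⟩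
  · have hm : Measurable fun X : Design n p => X i0 j := by fun_prop
    have h4 := lintegral_entry_four_le hX hA hp hC i0 j
    have h4' : ∫⁻ x, ENNReal.ofReal (x ^ 4) ∂(PX.map fun X => X i0 j) ≤
        ENNReal.ofReal (C : ℝ) := by
      rw [lintegral_map (by fun_prop) hm]
      simpa using h4
    have hprob := Measure.isProbabilityMeasure_map (μ := PX) hm.aemeasurable
    have hL : MemLp id 4 (PX.map fun X => X i0 j) := memLp_four_of_lintegral measurable_id h4'
    refine ⟨hprob, hL, ?_, ?_, ?_⟩
    · rw [integral_map hm.aemeasurable (by fun_prop)]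
      exact hX.mean_zero i0 j
    · rw [integral_map hm.aemeasurable (by fun_prop)]
      exact hX.second_moment_one i0 j
    · have hi : Integrable (fun x : ℝ => x ^ 4) (PX.map fun X => X i0 j) :=
        hL.integrable_pow_of_le_four le_rfl
      refine (ENNReal.ofReal_le_ofReal_iff (NNReal.coe_nonneg C)).1 ?_
      rw [ofReal_integral_eq_lintegral_ofReal hi (ae_of_all _ fun x => by positivity)]
      exact h4'
  · have := map_pi_pi_of_iIndepFun (P := PX) (fun i j X => X i j) (by fun_prop) hA
    simp_rw [hmap] at this
    rwa [show (fun (X : Design n p) i j => X i j) = id from rfl, Measure.map_id] at this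
  · have := map_pi_pi_of_iIndepFun (P := PX) (fun j i X => X i j) (by fun_prop)
      (hA.precomp (g := Prod.swap) Prod.swap_injective)
    simp_rw [hmap] at this
    exact this

end DesignStructure

theorem standardized_gaussianReal : ∃ C, Standardized C (gaussianReal 0 1) := by
  refine ⟨_, inferInstance, memLp_id_gaussianReal 4, integral_id_gaussianReal, ?_, le_rfl⟩
  have := variance_id_gaussianReal (μ := 0) (v := 1)
  rw [variance_eq_integral (by fun_prop)] at this
  simpa [integral_id_gaussianReal] using this

/-! ### Moments of a single vector `Y • X` -/

section RegressionVector

variable {p : ℕ} {C : ℝ} {ν : Fin p → Measure ℝ}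

/-- The vector `Y • X` of a single observation with design `z.1` and noise `z.2`. -/
noncomputable def regressionVector (θ : EuclideanSpace ℝ (Fin p)) (z : (Fin p → ℝ) × ℝ) :
    EuclideanSpace ℝ (Fin p) :=
  (∑ j, θ j * z.1 j + z.2) • WithLp.toLp 2 z.1

theorem measurable_regressionVector (θ : EuclideanSpace ℝ (Fin p)) :
    Measurable (regressionVector θ) := by
  unfold regressionVector
  fun_prop

theorem inner_regressionVector (θ v : EuclideanSpace ℝ (Fin p)) (z : (Fin p → ℝ) × ℝ) :
    inner ℝ (regressionVector θ z) v =
      z.2 * (∑ j, v j * z.1 j) + (∑ j, θ j * z.1 j) * ∑ j, v j * z.1 j := by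
  rw [regressionVector, real_inner_smul_left]
  simp only [PiLp.inner_apply, Real.inner_apply]
  simp_rw [mul_comm (z.1 _) (v _)]
  ring

/-- Polarization of the second moment identity for weighted sums. -/
theorem integral_weightedSum_mul (hν : ∀ j, Standardized C (ν j))
    (θ v : EuclideanSpace ℝ (Fin p)) :
    ∫ x, (∑ j, θ j * x j) * (∑ j, v j * x j) ∂(Measure.pi ν) = inner ℝ θ v := by
  have hp := fun j => (hν j).prob
  have hi : ∀ w : EuclideanSpace ℝ (Fin p),
      Integrable (fun x : Fin p → ℝ => (∑ j, w j * x j) ^ 2) (Measure.pi ν) := fun w =>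
    (memLp_weightedSum ν hν fun j => w j).integrable_pow_of_le_four (by norm_num)
  have hs : ∀ w : EuclideanSpace ℝ (Fin p),
      ∫ x, (∑ j, w j * x j) ^ 2 ∂(Measure.pi ν) = ‖w‖ ^ 2 := fun w => by
    rw [integral_weightedSum_sq ν hν, EuclideanSpace.real_norm_sq_eq]
  have e : ∀ x : Fin p → ℝ, (∑ j, θ j * x j) * (∑ j, v j * x j) =
      ((∑ j, (θ + v) j * x j) ^ 2 - (∑ j, (θ - v) j * x j) ^ 2) / 4 := by
    intro x
    simp only [PiLp.add_apply, PiLp.sub_apply, add_mul, sub_mul, Finset.sum_add_distrib,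
      Finset.sum_sub_distrib]
    ring
  simp_rw [e]
  rw [integral_div, integral_sub (hi _) (hi _), hs, hs,
    norm_add_sq_real, norm_sub_sq_real]
  ring

theorem lintegral_weightedSum_mul_sq_le (hC : 1 ≤ C) (hν : ∀ j, Standardized C (ν j))
    (θ v : EuclideanSpace ℝ (Fin p)) :
    ∫⁻ x, ENNReal.ofReal (((∑ j, θ j * x j) * (∑ j, v j * x j)) ^ 2) ∂(Measure.pi ν) ≤
      ENNReal.ofReal (4 * C * ‖θ‖ ^ 2 * ‖v‖ ^ 2) := by
  have h4 : ∀ w : EuclideanSpace ℝ (Fin p),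
      ∫⁻ x, ENNReal.ofReal ((∑ j, w j * x j) ^ 4) ∂(Measure.pi ν) ≤
        ENNReal.ofReal (4 * C * ‖w‖ ^ 4) := fun w => by
    refine (lintegral_weightedSum_four_le hC ν hν fun j => w j).trans (le_of_eq ?_)
    rw [← EuclideanSpace.real_norm_sq_eq]
    congr 1
    ring
  by_cases hθ : θ = 0
  · simp [hθ]
  by_cases hv : v = 0
  · simp [hv]
  have hθ' : 0 < ‖θ‖ := norm_pos_iff.2 hθ
  have hv' : 0 < ‖v‖ := norm_pos_iff.2 hv
  -- Young weights with `t * s = 1/4`, balanced so that both fourth moment terms become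
  -- `2C‖θ‖²‖v‖²`.
  set t := ‖v‖ ^ 2 / (2 * ‖θ‖ ^ 2) with ht
  set s := ‖θ‖ ^ 2 / (2 * ‖v‖ ^ 2) with hs
  calc _ ≤ ∫⁻ x : Fin p → ℝ, (ENNReal.ofReal t * ENNReal.ofReal ((∑ j, θ j * x j) ^ 4) +
          ENNReal.ofReal s * ENNReal.ofReal ((∑ j, v j * x j) ^ 4)) ∂(Measure.pi ν) := by
        refine lintegral_mono fun x => ?_
        rw [← ENNReal.ofReal_mul (by positivity), ← ENNReal.ofReal_mul (by positivity),
          ← ENNReal.ofReal_add (by positivity) (by positivity)]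
        refine ENNReal.ofReal_le_ofReal ?_
        set a := ∑ j, θ j * x j
        set b := ∑ j, v j * x j
        have : t * a ^ 4 + s * b ^ 4 - (a * b) ^ 2 =
            (‖v‖ ^ 2 * a ^ 2 - ‖θ‖ ^ 2 * b ^ 2) ^ 2 / (2 * ‖θ‖ ^ 2 * ‖v‖ ^ 2) := by
          rw [ht, hs]
          field_simp
          ring
        have h0 : 0 ≤ (‖v‖ ^ 2 * a ^ 2 - ‖θ‖ ^ 2 * b ^ 2) ^ 2 / (2 * ‖θ‖ ^ 2 * ‖v‖ ^ 2) := by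
          positivity
        linarith
    _ ≤ ENNReal.ofReal t * ENNReal.ofReal (4 * C * ‖θ‖ ^ 4) +
          ENNReal.ofReal s * ENNReal.ofReal (4 * C * ‖v‖ ^ 4) := by
        rw [lintegral_add_left (by fun_prop), lintegral_const_mul _ (by fun_prop),
          lintegral_const_mul _ (by fun_prop)]
        gcongr
        · exact h4 θ
        · exact h4 v
    _ = _ := by
        rw [← ENNReal.ofReal_mul (by positivity), ← ENNReal.ofReal_mul (by positivity),
          ← ENNReal.ofReal_add (by positivity) (by positivity)]
        congr 1
        rw [ht, hs]
        field_simp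
        ring

/-- With `a = ⟨θ, x⟩` and `b = ⟨v, x⟩`, the inner product with `v` is `ξb + ab`. Integrating the
noise first leaves mean `ab` and second moment `b² + (ab)²`. -/
theorem secondMomentBound_regressionVector (hC : 1 ≤ C) (hν : ∀ j, Standardized C (ν j))
    (θ : EuclideanSpace ℝ (Fin p)) :
    SecondMomentBound θ (1 + 4 * C * ‖θ‖ ^ 2)
      (((Measure.pi ν).prod (gaussianReal 0 1)).map (regressionVector θ)) := by
  have hp := fun j => (hν j).prob
  obtain ⟨K, hK⟩ := standardized_gaussianReal
  set ρ := (Measure.pi ν).prod (gaussianReal 0 1) with hρ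
  have hV := measurable_regressionVector θ
  have hle : ∀ v, ∫⁻ z, ENNReal.ofReal ((inner ℝ (regressionVector θ z) v) ^ 2) ∂ρ ≤
      ENNReal.ofReal ((1 + 4 * C * ‖θ‖ ^ 2) * ‖v‖ ^ 2) := by
    intro v
    rw [hρ, lintegral_prod _ (by fun_prop)]
    simp_rw [inner_regressionVector, hK.lintegral_affine_sq]
    calc _ = ∫⁻ x : Fin p → ℝ, (ENNReal.ofReal ((∑ j, v j * x j) ^ 2) +
          ENNReal.ofReal (((∑ j, θ j * x j) * (∑ j, v j * x j)) ^ 2)) ∂(Measure.pi ν) :=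
          lintegral_congr fun x => ENNReal.ofReal_add (by positivity) (by positivity)
      _ ≤ ENNReal.ofReal (‖v‖ ^ 2) + ENNReal.ofReal (4 * C * ‖θ‖ ^ 2 * ‖v‖ ^ 2) := by
          rw [lintegral_add_left (by fun_prop), EuclideanSpace.real_norm_sq_eq v]
          gcongr
          · exact lintegral_weightedSum_sq_le ν hν fun j => v j
          · rw [← EuclideanSpace.real_norm_sq_eq v]
            exact lintegral_weightedSum_mul_sq_le hC hν θ v
      _ = _ := by
          rw [← ENNReal.ofReal_add (by positivity) (by positivity)]
          congr 1
          ring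
  have hsq : ∀ v, Integrable (fun z => (inner ℝ (regressionVector θ z) v) ^ 2) ρ := by
    intro v
    refine ⟨by fun_prop, ?_⟩
    rw [hasFiniteIntegral_iff_ofReal (ae_of_all _ fun x => by positivity)]
    exact (hle v).trans_lt ENNReal.ofReal_lt_top
  have hL2 : ∀ v, MemLp (fun z => inner ℝ (regressionVector θ z) v) 2 ρ := fun v =>
    (memLp_two_iff_integrable_sq (by fun_prop)).2 (hsq v)
  refine ⟨Measure.isProbabilityMeasure_map hV.aemeasurable, fun v => ?_, fun v => ?_, fun v => ?_⟩
  · exact (memLp_map_measure_iff (by fun_prop) hV.aemeasurable).2 (hL2 v)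
  · rw [integral_map hV.aemeasurable (by fun_prop), hρ,
      integral_prod _ ((hL2 v).integrable (by norm_num))]
    simp_rw [inner_regressionVector, hK.integral_affine]
    exact integral_weightedSum_mul hν θ v
  · rw [integral_map hV.aemeasurable (by fun_prop)]
    refine (ENNReal.ofReal_le_ofReal_iff (by positivity)).1 ?_
    rw [ofReal_integral_eq_lintegral_ofReal (hsq v) (ae_of_all _ fun x => by positivity)]
    exact hle v

end RegressionVector

/-! ### Chebyshev bound for the type II error -/

section TypeTwo

variable {n p : ℕ}

theorem measurable_statT1 : Measurable (statT1 : Obs n p → ℝ) := by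
  unfold statT1 kernelK
  fun_prop

theorem measurable_response (θ : EuclideanSpace ℝ (Fin p)) :
    Measurable fun w : Design n p × (Fin n → ℝ) => (w.1, response θ w.1 w.2) := by
  unfold response
  fun_prop

theorem isProbabilityMeasure_modelLaw (PX : Measure (Design n p)) [IsProbabilityMeasure PX]
    (θ : EuclideanSpace ℝ (Fin p)) : IsProbabilityMeasure (modelLaw PX θ) :=
  Measure.isProbabilityMeasure_map (measurable_response θ).aemeasurable

theorem statT1_response (θ : EuclideanSpace ℝ (Fin p)) (X : Design n p) (ξ : Fin n → ℝ) :
    statT1 (X, response θ X ξ) = (Real.sqrt ((n : ℝ) * (n - 1) / 2))⁻¹ *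
      ((Real.sqrt p)⁻¹ * pairInner fun i => regressionVector θ (X i, ξ i)) := by
  unfold statT1 kernelK pairInner
  rw [← Finset.mul_sum]
  congr 2
  refine Finset.sum_congr rfl fun q _ => ?_
  simp only [regressionVector, response, real_inner_smul_left, real_inner_smul_right]
  simp only [PiLp.inner_apply, Real.inner_apply]
  ring

theorem map_regressionVector (ρ : Measure (Fin p → ℝ)) [IsProbabilityMeasure ρ]
    (θ : EuclideanSpace ℝ (Fin p)) :
    (((Measure.pi fun _ : Fin n => ρ).prod (Measure.pi fun _ : Fin n => gaussianReal 0 1)).map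
      fun w i => regressionVector θ (w.1 i, w.2 i)) =
      Measure.pi fun _ : Fin n => (ρ.prod (gaussianReal 0 1)).map (regressionVector θ) := by
  have h := measurePreserving_arrowProdEquivProdArrow (Fin p → ℝ) ℝ (Fin n) (fun _ => ρ)
    (fun _ => gaussianReal 0 1)
  have hV := measurable_regressionVector θ
  have hp : IsProbabilityMeasure ((ρ.prod (gaussianReal 0 1)).map (regressionVector θ)) :=
    Measure.isProbabilityMeasure_map hV.aemeasurable
  rw [← h.map_eq, Measure.map_map (by fun_prop) h.measurable,
    ← Measure.pi_map_pi (fun _ => hV.aemeasurable)]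
  rfl

theorem typeIIErrorAt_eq (PX : Measure (Design n p)) [IsProbabilityMeasure PX] (α : ℝ)
    (θ : EuclideanSpace ℝ (Fin p)) :
    typeIIErrorAt PX (testPsi1 n p α) θ =
      (modelLaw PX θ).real {Z | statT1 Z ≤ gaussianUpperQuantile α} := by
  have hm := measurableSet_le (measurable_statT1 (n := n) (p := p))
    (measurable_const (a := gaussianUpperQuantile α))
  rw [typeIIErrorAt, ← integral_indicator_one hm]
  congr 1
  ext Z
  by_cases h : statT1 Z ≤ gaussianUpperQuantile α
  · simp [testPsi1, h]
  · simp [testPsi1, h, not_le.1 h]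

theorem sq_div_four_le_pairCount (hn : 2 ≤ n) : (n : ℝ) ^ 2 / 4 ≤ (n : ℝ) * (n - 1) / 2 := by
  have : (2 : ℝ) ≤ n := by exact_mod_cast hn
  nlinarith

theorem typeIIErrorAt_le {C : ℝ} (hC : 1 ≤ C) {ν : Fin p → Measure ℝ}
    (hν : ∀ j, Standardized C (ν j)) (hn : 2 ≤ n) (hp : 1 ≤ p) {α r : ℝ} (hr : 0 < r)
    (hu : gaussianUpperQuantile α ≤ n * r ^ 2 / (4 * Real.sqrt p))
    (θ : EuclideanSpace ℝ (Fin p)) (hθ : r ≤ ‖θ‖) :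
    typeIIErrorAt (Measure.pi fun _ : Fin n => Measure.pi ν) (testPsi1 n p α) θ ≤
      128 * ((4 * C + 1 / r ^ 2) / n + (4 * C + 1 / r ^ 2) ^ 2 * (p / n ^ 2)) := by
  have hprob := fun j => (hν j).prob
  have hn2 : (2 : ℝ) ≤ n := by exact_mod_cast hn
  have hp1 : (1 : ℝ) ≤ p := by exact_mod_cast hp
  have hN := sq_div_four_le_pairCount hn
  have hh : 0 < ‖θ‖ := hr.trans_le hθ
  set N := (n : ℝ) * (n - 1) / 2 with hNdef
  have hNpos : 0 < N := lt_of_lt_of_le (by positivity) hN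
  have hlam : 0 ≤ 1 + 4 * C * ‖θ‖ ^ 2 := by positivity
  have hτ := secondMomentBound_regressionVector hC hν θ
  set τ := ((Measure.pi ν).prod (gaussianReal 0 1)).map (regressionVector θ) with hτdef
  -- Deviation from the mean `N‖θ‖²` by at least half of it; acceptance of the null forces this
  -- event.
  let S : Set (Fin n → EuclideanSpace ℝ (Fin p)) := {u | ENNReal.ofReal ((N * ‖θ‖ ^ 2 / 2) ^ 2) ≤
    ENNReal.ofReal ((pairInner u - N * ‖θ‖ ^ 2) ^ 2)}
  have hmP : Measurable (pairInner : (Fin n → EuclideanSpace ℝ (Fin p)) → ℝ) :=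
    measurable_pairInner
  have hmf : Measurable fun u : Fin n → EuclideanSpace ℝ (Fin p) =>
      ENNReal.ofReal ((pairInner u - N * ‖θ‖ ^ 2) ^ 2) := by fun_prop
  have hS : MeasurableSet S := measurableSet_le measurable_const hmf
  have hV := measurable_regressionVector θ
  have hsub : modelLaw (Measure.pi fun _ : Fin n => Measure.pi ν) θ
      {Z | statT1 Z ≤ gaussianUpperQuantile α} ≤ (Measure.pi fun _ : Fin n => τ) S := by
    rw [modelLaw, Measure.map_apply (measurable_response θ)
      (measurableSet_le measurable_statT1 measurable_const), hτdef, ← map_regressionVector,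
      Measure.map_apply (by fun_prop) hS]
    refine measure_mono fun w hw => ?_
    simp only [Set.mem_preimage, Set.mem_ofPred_eq, statT1_response] at hw
    refine ENNReal.ofReal_le_ofReal ?_
    set P := pairInner fun i => regressionVector θ (w.1 i, w.2 i)
    have hsp : 0 < Real.sqrt p := Real.sqrt_pos.2 (by linarith)
    have hsN : 0 < Real.sqrt N := Real.sqrt_pos.2 hNpos
    have hsN2 : Real.sqrt N ^ 2 = N := Real.sq_sqrt hNpos.le
    have hnN : (n : ℝ) ≤ 2 * Real.sqrt N := by
      refine le_of_sq_le_sq ?_ (by positivity)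
      rw [mul_pow, hsN2]
      linarith
    have h1 : P ≤ Real.sqrt N * (n * r ^ 2 / 4) := by
      have h2 := hw.trans hu
      rw [← hNdef, inv_mul_le_iff₀ hsN, inv_mul_le_iff₀ hsp] at h2
      refine h2.trans (le_of_eq ?_)
      field_simp
    have h2 : Real.sqrt N * (n * r ^ 2 / 4) ≤ N * ‖θ‖ ^ 2 / 2 := by
      calc Real.sqrt N * (n * r ^ 2 / 4) ≤ Real.sqrt N * (2 * Real.sqrt N * ‖θ‖ ^ 2 / 4) := by
            gcongr
        _ = Real.sqrt N ^ 2 * ‖θ‖ ^ 2 / 2 := by ring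
        _ = _ := by rw [hsN2]
    have h3 : 0 ≤ N * ‖θ‖ ^ 2 := by positivity
    nlinarith
  have hmarkov := (mul_meas_ge_le_lintegral (μ := Measure.pi fun _ : Fin n => τ) hmf
    (ENNReal.ofReal ((N * ‖θ‖ ^ 2 / 2) ^ 2))).trans (hτ.lintegral_pairInner_sub_sq_le hlam n)
  have hb : 0 < (N * ‖θ‖ ^ 2 / 2) ^ 2 := by positivity
  set B := 2 * (n : ℝ) ^ 3 * ((1 + 4 * C * ‖θ‖ ^ 2) * ‖θ‖ ^ 2) +
    2 * (n : ℝ) ^ 2 * ((1 + 4 * C * ‖θ‖ ^ 2) ^ 2 *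
      Module.finrank ℝ (EuclideanSpace ℝ (Fin p))) with hB
  have hle : modelLaw (Measure.pi fun _ : Fin n => Measure.pi ν) θ
      {Z | statT1 Z ≤ gaussianUpperQuantile α} ≤
        ENNReal.ofReal (B / (N * ‖θ‖ ^ 2 / 2) ^ 2) := by
    rw [ENNReal.ofReal_div_of_pos hb]
    refine hsub.trans ?_
    rw [ENNReal.le_div_iff_mul_le (Or.inl (ENNReal.ofReal_pos.2 hb).ne') (Or.inl (by simp)), mul_comm]
    exact hmarkov
  rw [typeIIErrorAt_eq, measureReal_def]
  refine (ENNReal.toReal_le_of_le_ofReal (by positivity) hle).trans ?_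
  have hfr : Module.finrank ℝ (EuclideanSpace ℝ (Fin p)) = p := by simp
  -- Making the bound homogeneous in `‖θ‖` lets `‖θ‖⁴` cancel below, so the result is uniform over
  -- the alternative.
  have hinv : (1 + 4 * C * ‖θ‖ ^ 2) ≤ (4 * C + 1 / r ^ 2) * ‖θ‖ ^ 2 := by
    have : 1 ≤ 1 / r ^ 2 * ‖θ‖ ^ 2 := by
      rw [one_div, inv_mul_eq_div, one_le_div (by positivity)]
      gcongr
    linarith
  have hden : ((n : ℝ) ^ 2 / 4 * ‖θ‖ ^ 2 / 2) ^ 2 ≤ (N * ‖θ‖ ^ 2 / 2) ^ 2 := by gcongr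
  calc B / (N * ‖θ‖ ^ 2 / 2) ^ 2 ≤ B / ((n : ℝ) ^ 2 / 4 * ‖θ‖ ^ 2 / 2) ^ 2 := by gcongr
    _ ≤ (2 * (n : ℝ) ^ 3 * (((4 * C + 1 / r ^ 2) * ‖θ‖ ^ 2) * ‖θ‖ ^ 2) +
          2 * (n : ℝ) ^ 2 * (((4 * C + 1 / r ^ 2) * ‖θ‖ ^ 2) ^ 2 * p)) /
          ((n : ℝ) ^ 2 / 4 * ‖θ‖ ^ 2 / 2) ^ 2 := by
        rw [hB, hfr]
        gcongr
    _ = _ := by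
        field_simp
        ring

end TypeTwo

/-! ### Quantitative expansion of characteristic functions -/

section CharFunBound

/-- The even part has a fourth order error and the odd part a third order one: Taylor bounds for
`|x| ≤ 1`, trivial bounds beyond. -/
theorem norm_exp_mul_I_sub_le (x : ℝ) :
    ‖Complex.exp (x * Complex.I) - (1 + x * Complex.I - x ^ 2 / 2)‖ ≤ 2 * |x| ^ 3 + x ^ 4 := by
  have e : Complex.exp (x * Complex.I) - (1 + x * Complex.I - x ^ 2 / 2) =
      ((Real.cos x - (1 - x ^ 2 / 2) : ℝ) : ℂ) + ((Real.sin x - x : ℝ) : ℂ) * Complex.I := by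
    rw [Complex.exp_mul_I]
    push_cast
    ring
  have hx4 : |x| ^ 4 = x ^ 4 := Even.pow_abs (by decide) x
  have h1 : |Real.cos x - (1 - x ^ 2 / 2)| ≤ x ^ 4 := by
    rcases le_total |x| 1 with h | h
    · have := Real.cos_bound h
      rw [hx4] at this
      have h0 : 0 ≤ x ^ 4 := by positivity
      exact this.trans (by linarith)
    · have h2 : 1 ≤ x ^ 2 := by rw [← sq_abs]; nlinarith
      rw [abs_of_nonneg (by linarith [Real.one_sub_sq_div_two_le_cos (x := x)])]
      nlinarith [Real.cos_le_one x]
  have h2 : |Real.sin x - x| ≤ 2 * |x| ^ 3 := by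
    rcases le_total |x| 1 with h | h
    · have h3 := Real.sin_bound h
      have h4 : |Real.sin x - x| ≤ |Real.sin x - (x - x ^ 3 / 6)| + |x ^ 3 / 6| := by
        have := abs_sub (Real.sin x - (x - x ^ 3 / 6)) (x ^ 3 / 6)
        rwa [show Real.sin x - (x - x ^ 3 / 6) - x ^ 3 / 6 = Real.sin x - x by ring] at this
      have h5 : |x ^ 3 / 6| = |x| ^ 3 / 6 := by rw [abs_div, abs_pow]; norm_num
      have h6 : |x| ^ 5 ≤ |x| ^ 3 := pow_le_pow_of_le_one (abs_nonneg x) h (by norm_num)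
      have h7 : 0 ≤ |x| ^ 3 := by positivity
      rw [h5] at h4
      linarith
    · have h3 : |Real.sin x - x| ≤ |Real.sin x| + |x| := abs_sub _ _
      have h4 := Real.abs_sin_le_one x
      have h5 : |x| ≤ |x| ^ 3 := le_self_pow₀ h (by norm_num)
      linarith
  rw [e]
  refine (norm_add_le _ _).trans ?_
  rw [norm_mul, Complex.norm_I, Complex.norm_real, Complex.norm_real, mul_one,
    Real.norm_eq_abs, Real.norm_eq_abs]
  linarith

theorem norm_prod_sub_prod_le {ι : Type*} (s : Finset ι) (a b : ι → ℂ)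
    (ha : ∀ i ∈ s, ‖a i‖ ≤ 1) (hb : ∀ i ∈ s, ‖b i‖ ≤ 1) :
    ‖∏ i ∈ s, a i - ∏ i ∈ s, b i‖ ≤ ∑ i ∈ s, ‖a i - b i‖ := by
  classical
  induction s using Finset.induction_on with
  | empty => simp
  | insert i s hi ih =>
    rw [Finset.prod_insert hi, Finset.prod_insert hi, Finset.sum_insert hi]
    have e : a i * ∏ j ∈ s, a j - b i * ∏ j ∈ s, b j =
        (a i - b i) * ∏ j ∈ s, a j + b i * (∏ j ∈ s, a j - ∏ j ∈ s, b j) := by ring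
    rw [e]
    refine (norm_add_le _ _).trans (add_le_add ?_ ?_)
    · rw [norm_mul]
      refine mul_le_of_le_one_right (norm_nonneg _) ?_
      rw [norm_prod]
      exact Finset.prod_le_one (fun _ _ => norm_nonneg _) fun j hj =>
        ha j (Finset.mem_insert_of_mem hj)
    · rw [norm_mul]
      refine (mul_le_of_le_one_left (norm_nonneg _) (hb i (Finset.mem_insert_self _ _))).trans ?_
      exact ih (fun j hj => ha j (Finset.mem_insert_of_mem hj))
        fun j hj => hb j (Finset.mem_insert_of_mem hj)

/-- The upper bound uses `(1 + z + z²/2)(1 - z + z²/2) = 1 + z⁴/4 ≥ 1`. -/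
theorem abs_exp_neg_sub_le {z : ℝ} (hz : 0 ≤ z) : |Real.exp (-z) - (1 - z)| ≤ z ^ 2 / 2 := by
  rw [abs_of_nonneg (by linarith [Real.one_sub_le_exp_neg z])]
  have h := Real.quadratic_le_exp_of_nonneg hz
  have hpos : 0 < 1 + z + z ^ 2 / 2 := by positivity
  have h2 : Real.exp (-z) ≤ (1 + z + z ^ 2 / 2)⁻¹ := by
    rw [Real.exp_neg]
    gcongr
  have h3 : (1 + z + z ^ 2 / 2)⁻¹ ≤ 1 - z + z ^ 2 / 2 := by
    rw [inv_le_iff_one_le_mul₀ hpos]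
    nlinarith [sq_nonneg (z ^ 2)]
  linarith

/-- Quantitative second order expansion of a characteristic function at the scale `1 / q`. -/
theorem norm_charFun_sub_exp_le {μ : Measure ℝ} [IsProbabilityMeasure μ] (hL : MemLp id 4 μ)
    {v B : ℝ} (h1 : ∫ x, x ∂μ = 0) (h2 : ∫ x, x ^ 2 ∂μ = v) (h4 : ∫ x, x ^ 4 ∂μ ≤ B)
    (s : ℝ) {q : ℝ} (hq : 1 ≤ q) :
    ‖charFun μ (s / q) - Complex.exp ((-(v * s ^ 2 / (2 * q ^ 2)) : ℝ))‖ ≤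
      (1 + 3 * s ^ 4 * B) / q ^ 3 := by
  have i1 : Integrable (fun x : ℝ => x) μ := hL.integrable (by norm_num)
  have i2 : Integrable (fun x : ℝ => x ^ 2) μ := hL.integrable_pow_of_le_four (by norm_num)
  have i4 : Integrable (fun x : ℝ => x ^ 4) μ := hL.integrable_pow_of_le_four (by norm_num)
  have hv : 0 ≤ v := h2 ▸ integral_nonneg fun x => sq_nonneg x
  have hvB : v ^ 2 ≤ B := by
    have : ∫ x, (x ^ 2 * (2 * v) - v ^ 2) ∂μ ≤ ∫ x, x ^ 4 ∂μ :=
      integral_mono ((i2.mul_const _).sub (integrable_const _)) i4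
        fun x => by nlinarith [sq_nonneg (x ^ 2 - v)]
    rw [integral_sub (i2.mul_const _) (integrable_const _), integral_mul_const, h2] at this
    simp at this
    nlinarith
  have hB : 0 ≤ B := (sq_nonneg v).trans hvB
  have hq0 : 0 < q := by linarith
  set τ := s / q with hτ
  have iI : Integrable (fun x : ℝ => ((τ * x : ℝ) : ℂ) * Complex.I) μ :=
    ((i1.const_mul τ).ofReal).mul_const _
  have iS : Integrable (fun x : ℝ => ((τ * x : ℝ) : ℂ) ^ 2 / 2) μ := by
    have : (fun x : ℝ => ((τ * x : ℝ) : ℂ) ^ 2 / 2) =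
        fun x : ℝ => ((τ ^ 2 / 2 * x ^ 2 : ℝ) : ℂ) := by
      ext x; push_cast; ring
    rw [this]
    exact (i2.const_mul _).ofReal
  have iE : Integrable (fun x : ℝ => Complex.exp (((τ * x : ℝ) : ℂ) * Complex.I)) μ := by
    refine Integrable.of_bound (by fun_prop) 1 (ae_of_all _ fun x => ?_)
    rw [Complex.norm_exp_ofReal_mul_I]
  have iL : Integrable (fun x : ℝ => 1 + ((τ * x : ℝ) : ℂ) * Complex.I) μ :=
    (integrable_const _).add iI
  have iQ : Integrable
      (fun x : ℝ => 1 + ((τ * x : ℝ) : ℂ) * Complex.I - ((τ * x : ℝ) : ℂ) ^ 2 / 2) μ := iL.sub iS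
  have hint : ∫ x, (1 + ((τ * x : ℝ) : ℂ) * Complex.I - ((τ * x : ℝ) : ℂ) ^ 2 / 2) ∂μ =
      ((1 - v * s ^ 2 / (2 * q ^ 2) : ℝ) : ℂ) := by
    have e2 : ∫ x, ((τ * x : ℝ) : ℂ) ^ 2 / 2 ∂μ = ((v * s ^ 2 / (2 * q ^ 2) : ℝ) : ℂ) := by
      have : (fun x : ℝ => ((τ * x : ℝ) : ℂ) ^ 2 / 2) =
          fun x : ℝ => ((τ ^ 2 / 2 * x ^ 2 : ℝ) : ℂ) := by
        ext x; push_cast; ring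
      rw [this, integral_complex_ofReal, integral_const_mul, h2, hτ]
      congr 1
      field_simp
    have e1 : ∫ x, ((τ * x : ℝ) : ℂ) * Complex.I ∂μ = 0 := by
      rw [integral_mul_const, integral_complex_ofReal, integral_const_mul, h1]
      simp
    rw [integral_sub iL iS, integral_add (integrable_const _) iI, e1, e2]
    simp
  have hA : ‖charFun μ τ - ((1 - v * s ^ 2 / (2 * q ^ 2) : ℝ) : ℂ)‖ ≤
      (s ^ 2 * v + 2 * s ^ 4 * B) / q ^ 3 := by
    rw [charFun_apply_real, ← hint]
    have e : ∀ x : ℝ, Complex.exp ((τ : ℂ) * x * Complex.I) =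
        Complex.exp (((τ * x : ℝ) : ℂ) * Complex.I) := fun x => by push_cast; rfl
    simp_rw [e]
    rw [← integral_sub iE iQ]
    have ib : Integrable (fun x : ℝ => (s ^ 2 * x ^ 2 + 2 * s ^ 4 * x ^ 4) / q ^ 3) μ :=
      ((i2.const_mul _).add (i4.const_mul _)).div_const _
    refine (norm_integral_le_of_norm_le ib (ae_of_all _ fun x => ?_)).trans ?_
    · refine (norm_exp_mul_I_sub_le (τ * x)).trans ?_
      have hy : τ * x = s * x / q := by rw [hτ]; ring
      have e1 : 2 * |τ * x| ^ 3 + (τ * x) ^ 4 =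
          2 * |s * x| ^ 3 / q ^ 3 + (s * x) ^ 4 / q ^ 4 := by
        rw [hy, abs_div, abs_of_pos hq0]
        ring
      rw [e1]
      have e2 : (s * x) ^ 4 / q ^ 4 ≤ (s * x) ^ 4 / q ^ 3 := by
        have : q ^ 3 ≤ q ^ 4 := pow_le_pow_right₀ hq (by norm_num)
        gcongr
      -- Trades the third absolute moment for the second and fourth.
      have e3 : 2 * |s * x| ^ 3 ≤ (s * x) ^ 2 + (s * x) ^ 4 := by
        rw [← sq_abs (s * x), ← Even.pow_abs (by decide : Even 4) (s * x)]
        nlinarith [sq_nonneg (|s * x| ^ 2 - |s * x|)]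
      calc _ ≤ ((s * x) ^ 2 + (s * x) ^ 4) / q ^ 3 + (s * x) ^ 4 / q ^ 3 := by gcongr
        _ = _ := by ring
    · rw [integral_div, integral_add (i2.const_mul _) (i4.const_mul _), integral_const_mul,
        integral_const_mul, h2]
      gcongr
  have hE : ‖((1 - v * s ^ 2 / (2 * q ^ 2) : ℝ) : ℂ) -
      Complex.exp ((-(v * s ^ 2 / (2 * q ^ 2)) : ℝ))‖ ≤ (s ^ 4 * B / 2) / q ^ 3 := by
    rw [← Complex.ofReal_exp, ← Complex.ofReal_sub, Complex.norm_real, Real.norm_eq_abs,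
      abs_sub_comm]
    refine (abs_exp_neg_sub_le (by positivity)).trans ?_
    have : q ^ 3 ≤ q ^ 4 := pow_le_pow_right₀ hq (by norm_num)
    calc (v * s ^ 2 / (2 * q ^ 2)) ^ 2 / 2 = s ^ 4 * v ^ 2 / 8 / q ^ 4 := by
          field_simp
          ring
      _ ≤ s ^ 4 * B / 2 / q ^ 3 := by
          have : 0 ≤ s ^ 4 * B := by positivity
          have h5 : s ^ 4 * v ^ 2 / 8 ≤ s ^ 4 * B / 2 := by
            have := mul_le_mul_of_nonneg_left hvB (by positivity : 0 ≤ s ^ 4)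
            linarith
          gcongr
  have hs2 : s ^ 2 * v ≤ 1 / 2 + s ^ 4 * B / 2 := by
    have := mul_le_mul_of_nonneg_left hvB (by positivity : 0 ≤ s ^ 4)
    nlinarith [sq_nonneg (s ^ 2 * v - 1)]
  refine (norm_sub_le_norm_sub_add_norm_sub _ _ _).trans ((add_le_add hA hE).trans ?_)
  rw [← add_div]
  refine div_le_div_of_nonneg_right ?_ (by positivity)
  have : 0 ≤ s ^ 4 * B := by positivity
  linarith

end CharFunBound

/-! ### From characteristic functions to tail probabilities -/

section LevyBound

/-- Pointwise closeness of characteristic functions, with a given profile, forces closeness of the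
tail probabilities. -/
theorem exists_delta_of_charFun_bound (μ₀ : Measure ℝ) [IsProbabilityMeasure μ₀]
    [NullSingletonClass μ₀] (K : ℝ → ℝ) (u : ℝ) {ε : ℝ} (hε : 0 < ε) :
    ∃ δ > 0, ∀ μ : Measure ℝ, IsProbabilityMeasure μ →
      (∀ t, ‖charFun μ t - charFun μ₀ t‖ ≤ K t * δ) →
      |μ.real (Set.Ioi u) - μ₀.real (Set.Ioi u)| < ε := by
  -- Counterexamples for `δ = 1/(k+1)` form a sequence, to which Lévy continuity applies. The
  -- resulting uniform `δ` works along any filter, countably generated or not.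
  by_contra! hcon
  choose μ hμ hK hbad using fun k : ℕ => hcon (1 / ((k : ℝ) + 1)) (by positivity)
  let M : ℕ → ProbabilityMeasure ℝ := fun k => ⟨μ k, hμ k⟩
  let M₀ : ProbabilityMeasure ℝ := ⟨μ₀, inferInstance⟩
  have hlim : Tendsto M atTop (𝓝 M₀) := by
    refine ProbabilityMeasure.tendsto_of_tendsto_charFun fun t => ?_
    rw [tendsto_iff_norm_sub_tendsto_zero]
    refine squeeze_zero (fun _ => norm_nonneg _) (fun k => hK k t) ?_
    simpa using tendsto_one_div_add_atTop_nhds_zero_nat.const_mul (K t)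
  have hfr : (M₀ : Measure ℝ) (frontier (Set.Ioi u)) = 0 := by
    rw [frontier_Ioi]
    exact measure_singleton (μ := μ₀) u
  have h := ProbabilityMeasure.tendsto_measure_of_null_frontier_of_tendsto' hlim hfr
  have h' : Tendsto (fun k => (μ k).real (Set.Ioi u)) atTop (𝓝 (μ₀.real (Set.Ioi u))) :=
    (ENNReal.tendsto_toReal (measure_ne_top _ _)).comp h
  obtain ⟨k, hk⟩ := ((Metric.tendsto_nhds.1 h') ε hε).exists
  rw [Real.dist_eq] at hk
  exact absurd hk (not_lt.2 (hbad k))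

end LevyBound

/-! ### The Gaussian quantile -/

section Quantile

/-- Without atoms the distribution function is continuous, so the infimum is attained and its value
there is exactly `1 - α`. -/
theorem gaussianReal_Ioi_quantile {α : ℝ} (hα : α ∈ Set.Ioo (0 : ℝ) 1) :
    (gaussianReal 0 1).real (Set.Ioi (gaussianUpperQuantile α)) = α := by
  have hna : NullSingletonClass (gaussianReal 0 1) :=
    nullSingletonClass_gaussianReal (by norm_num)
  set F := cdf (gaussianReal 0 1)
  have hF : ∀ x, F x = (gaussianReal 0 1).real (Set.Iic x) := fun x => cdf_eq_real _ x
  have hcont : Continuous F := by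
    refine continuous_iff_continuousAt.2 fun x => ?_
    rw [F.mono.continuousAt_iff_leftLim_eq_rightLim, F.rightLim_eq]
    have h0 : F.measure {x} = 0 := by
      rw [measure_cdf]
      exact measure_singleton x
    rw [StieltjesFunction.measure_singleton, ENNReal.ofReal_eq_zero] at h0
    exact le_antisymm (F.mono.leftLim_le le_rfl) (by linarith)
  set S := {x : ℝ | 1 - α ≤ F x} with hS
  have hne : S.Nonempty := by
    have := (tendsto_cdf_atTop (gaussianReal 0 1)).eventually
      (eventually_ge_nhds (show 1 - α < 1 by linarith [hα.1]))
    exact this.exists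
  have hbdd : BddBelow S := by
    obtain ⟨x, hx⟩ := ((tendsto_cdf_atBot (gaussianReal 0 1)).eventually
      (eventually_lt_nhds (show 0 < 1 - α by linarith [hα.2]))).exists
    refine ⟨x, fun y hy => ?_⟩
    by_contra! hlt
    have h1 : F y ≤ F x := F.mono hlt.le
    have h2 : 1 - α ≤ F y := hy
    have h3 : F x < 1 - α := hx
    linarith
  have hcl : IsClosed S := isClosed_le continuous_const hcont
  have hu : gaussianUpperQuantile α ∈ S := hcl.csInf_mem hne hbdd
  have hle : F (gaussianUpperQuantile α) ≤ 1 - α := by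
    refine le_of_tendsto (hcont.continuousWithinAt (s := Set.Iio (gaussianUpperQuantile α)))
      (eventually_nhdsWithin_of_forall fun y hy => ?_)
    by_contra! hlt
    exact absurd (csInf_le hbdd (show y ∈ S from hlt.le)) (not_le.2 hy)
  have heq : F (gaussianUpperQuantile α) = 1 - α := le_antisymm hle hu
  rw [← Set.compl_Iic, probReal_compl_eq_one_sub measurableSet_Iic, ← hF, heq]
  ring

end Quantile

/-! ### Characteristic function of the statistic under the null -/

section TypeOne

variable {n p : ℕ}

theorem statT1_eq_sum_columns (X : Design n p) (ξ : Fin n → ℝ) :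
    statT1 (X, ξ) = (Real.sqrt ((n : ℝ) * (n - 1) / 2))⁻¹ *
      ((Real.sqrt p)⁻¹ * ∑ j, pairInner fun i => ξ i * X i j) := by
  unfold statT1 kernelK pairInner
  rw [← Finset.mul_sum, Finset.sum_comm]
  congr 2
  refine Finset.sum_congr rfl fun q _ => ?_
  rw [Finset.mul_sum]
  refine Finset.sum_congr rfl fun j _ => ?_
  rw [Real.inner_apply]
  ring

theorem response_zero (X : Design n p) (ξ : Fin n → ℝ) : response 0 X ξ = ξ := by
  ext i
  simp [response]

/-- Given the noise, the characteristic function is a product over columns. Replacing each factor by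
a Gaussian one costs order `p^{-3/2}`, and there are `p` factors. The constant `48` is `3 * 16`. -/
theorem norm_charFun_sum_columns_sub_le {C : ℝ} (hC : 1 ≤ C) {PX : Measure (Design n p)}
    {ν : Fin p → Measure ℝ} (hν : ∀ j, Standardized C (ν j))
    (hPX : PX.map (fun X j i => X i j) = Measure.pi fun j => Measure.pi fun _ : Fin n => ν j)
    (hp : 1 ≤ p) (ξ : Fin n → ℝ) (s : ℝ) :
    ‖charFun (PX.map fun X => ∑ j, pairInner fun i => ξ i * X i j) (s / Real.sqrt p) -
      Complex.exp ((-(s ^ 2 * (pairInner fun i => ξ i ^ 2) / 2) : ℝ))‖ ≤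
      (1 + 48 * s ^ 4 * (C ^ 2 * (∑ i, ξ i ^ 2) ^ 4)) / Real.sqrt p := by
  have hprob := fun j => (hν j).prob
  have hp1 : (1 : ℝ) ≤ p := by exact_mod_cast hp
  set q := Real.sqrt p with hq
  have hq1 : 1 ≤ q := Real.one_le_sqrt.2 hp1
  have hq2 : q ^ 2 = p := Real.sq_sqrt (by linarith)
  have hW : Measurable fun x : Fin n → ℝ => pairInner fun i => ξ i * x i :=
    measurable_pairInner.comp (by fun_prop)
  let m : Fin p → Measure ℝ := fun j =>
    (Measure.pi fun _ : Fin n => ν j).map fun x => pairInner fun i => ξ i * x i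
  have hm : ∀ j, IsProbabilityMeasure (m j) :=
    fun j => Measure.isProbabilityMeasure_map hW.aemeasurable
  have hlaw : PX.map (fun X => ∑ j, pairInner fun i => ξ i * X i j) =
      (Measure.pi m).map fun w => ∑ j, w j := by
    have h1 : Measure.pi m = (Measure.pi fun j => Measure.pi fun _ : Fin n => ν j).map
        fun (x : Fin p → Fin n → ℝ) j => pairInner fun i => ξ i * x j i :=
      (Measure.pi_map_pi fun _ => hW.aemeasurable).symm
    have h2 : Measurable fun (x : Fin p → Fin n → ℝ) j => pairInner fun i => ξ i * x j i :=
      measurable_pi_lambda _ fun j => hW.comp (measurable_pi_apply j)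
    rw [h1, ← hPX, Measure.map_map h2 (by fun_prop), Measure.map_map (by fun_prop)
      (h2.comp (by fun_prop))]
    rfl
  set v := pairInner fun i => ξ i ^ 2 with hv
  have hb : ∀ j, ‖charFun (m j) (s / q) - Complex.exp ((-(v * s ^ 2 / (2 * q ^ 2)) : ℝ))‖ ≤
      (1 + 3 * s ^ 4 * (16 * C ^ 2 * (∑ i, ξ i ^ 2) ^ 4)) / q ^ 3 := by
    intro j
    have hL := memLp_pairInner (fun _ : Fin n => ν j) (fun _ => hν j) ξ
    refine norm_charFun_sub_exp_le ?_ ?_ ?_ ?_ s hq1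
    · exact (memLp_map_measure_iff (by fun_prop) hW.aemeasurable).2 hL
    · rw [integral_map hW.aemeasurable (by fun_prop)]
      exact integral_pairInner _ (fun _ => hν j) ξ
    · rw [integral_map hW.aemeasurable (by fun_prop)]
      exact integral_pairInner_sq _ (fun _ => hν j) ξ
    · rw [integral_map hW.aemeasurable (by fun_prop)]
      refine (ENNReal.ofReal_le_ofReal_iff (by positivity)).1 ?_
      rw [ofReal_integral_eq_lintegral_ofReal (hL.integrable_pow_of_le_four le_rfl)
        (ae_of_all _ fun x => by positivity)]
      exact lintegral_pairInner_four_le hC _ (fun _ => hν j) ξ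
  have hv0 : 0 ≤ v := Finset.sum_nonneg fun q _ => by
    rw [Real.inner_apply]
    positivity
  have hexp : Complex.exp ((-(s ^ 2 * v / 2) : ℝ)) =
      ∏ _j : Fin p, Complex.exp ((-(v * s ^ 2 / (2 * q ^ 2)) : ℝ)) := by
    rw [Finset.prod_const, ← Complex.exp_nat_mul, Finset.card_univ, Fintype.card_fin]
    congr 1
    rw [← Complex.ofReal_natCast, ← Complex.ofReal_mul, ← hq2]
    congr 1
    field_simp
  rw [hlaw, charFun_map_sum_pi_eq_prod, Finset.prod_apply, hexp]
  refine (norm_prod_sub_prod_le _ _ _ (fun j _ => norm_charFun_le_one _)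
    fun j _ => ?_).trans ?_
  · rw [← Complex.ofReal_exp, Complex.norm_real, Real.norm_eq_abs, Real.abs_exp,
      Real.exp_le_one_iff]
    have : 0 ≤ v * s ^ 2 / (2 * q ^ 2) := by positivity
    linarith
  · refine (Finset.sum_le_sum fun j _ => hb j).trans (le_of_eq ?_)
    rw [Finset.sum_const, Finset.card_univ, Fintype.card_fin, nsmul_eq_mul, ← hq2]
    field_simp
    ring

/-- Squared noise is the one-dimensional case with mean `1`, so the U-statistic bound also controls
the conditional variance `v(ξ)`. -/
theorem exists_secondMomentBound_gaussian_sq : ∃ lam : ℝ, 0 ≤ lam ∧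
    SecondMomentBound (1 : ℝ) lam ((gaussianReal 0 1).map fun x => x ^ 2) := by
  obtain ⟨K, hK⟩ := standardized_gaussianReal
  have hm : Measurable fun x : ℝ => x ^ 2 := by fun_prop
  refine ⟨∫ x, x ^ 4 ∂(gaussianReal 0 1), integral_nonneg fun x => by positivity,
    Measure.isProbabilityMeasure_map hm.aemeasurable, fun v => ?_, fun v => ?_, fun v => ?_⟩
  · refine (memLp_map_measure_iff (by fun_prop) hm.aemeasurable).2 ?_
    refine (memLp_two_iff_integrable_sq (by fun_prop)).2 ?_
    refine ((hK.integrable_pow le_rfl).mul_const (v ^ 2)).congr (ae_of_all _ fun x => ?_)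
    simp only [Function.comp_apply, Real.inner_apply]
    ring
  · rw [integral_map hm.aemeasurable (by fun_prop)]
    simp only [Real.inner_apply]
    rw [integral_mul_const, hK.second]
  · rw [integral_map hm.aemeasurable (by fun_prop)]
    simp only [Real.inner_apply, mul_pow]
    rw [integral_mul_const]
    refine le_of_eq ?_
    simp [← pow_mul]

/-- Mean square deviation of the normalized conditional variance of `statT1` given the noise. -/
theorem exists_integral_pairInner_gaussian_sq_le : ∃ L : ℝ, ∀ n : ℕ, 2 ≤ n →
    Integrable (fun ξ : Fin n → ℝ =>
      ((pairInner fun i => ξ i ^ 2) / ((n : ℝ) * (n - 1) / 2) - 1) ^ 2)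
      (Measure.pi fun _ => gaussianReal 0 1) ∧
    ∫ ξ : Fin n → ℝ, ((pairInner fun i => ξ i ^ 2) / ((n : ℝ) * (n - 1) / 2) - 1) ^ 2
      ∂(Measure.pi fun _ => gaussianReal 0 1) ≤ L / n := by
  obtain ⟨lam, hlam, h⟩ := exists_secondMomentBound_gaussian_sq
  refine ⟨32 * (lam + lam ^ 2), fun n hn => ?_⟩
  have hn2 : (2 : ℝ) ≤ n := by exact_mod_cast hn
  have hN := sq_div_four_le_pairCount hn
  set N := (n : ℝ) * (n - 1) / 2 with hNdef
  have hNpos : 0 < N := lt_of_lt_of_le (by positivity) hN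
  have hprob := h.prob
  have hP : Measurable (pairInner : (Fin n → ℝ) → ℝ) := measurable_pairInner
  have hP2 : Measurable fun ξ : Fin n → ℝ => pairInner fun i => ξ i ^ 2 :=
    hP.comp (by fun_prop)
  have hlin := h.lintegral_pairInner_sub_sq_le hlam n
  rw [← Measure.pi_map_pi (fun _ => by fun_prop), lintegral_map (by fun_prop) (by fun_prop)]
    at hlin
  have hle : ∫⁻ ξ : Fin n → ℝ, ENNReal.ofReal (((pairInner fun i => ξ i ^ 2) / N - 1) ^ 2)
      ∂(Measure.pi fun _ => gaussianReal 0 1) ≤ ENNReal.ofReal (32 * (lam + lam ^ 2) / n) := by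
    have e : ∀ ξ : Fin n → ℝ, ENNReal.ofReal (((pairInner fun i => ξ i ^ 2) / N - 1) ^ 2) =
        ENNReal.ofReal ((N ^ 2)⁻¹) * ENNReal.ofReal (((pairInner fun i => ξ i ^ 2) -
          N * ‖(1 : ℝ)‖ ^ 2) ^ 2) := fun ξ => by
      rw [← ENNReal.ofReal_mul (by positivity)]
      congr 1
      rw [norm_one]
      field_simp
    simp_rw [e]
    rw [lintegral_const_mul _ (by fun_prop)]
    refine (mul_le_mul_right hlin _).trans ?_
    rw [← ENNReal.ofReal_mul (by positivity)]
    refine ENNReal.ofReal_le_ofReal ?_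
    have hinv : (N ^ 2)⁻¹ ≤ (((n : ℝ) ^ 2 / 4) ^ 2)⁻¹ := by gcongr
    simp only [norm_one, one_pow, mul_one, Module.finrank_self, Nat.cast_one]
    calc _ ≤ (((n : ℝ) ^ 2 / 4) ^ 2)⁻¹ * (2 * n ^ 3 * lam + 2 * n ^ 3 * lam ^ 2) := by
          have : (n : ℝ) ^ 2 ≤ n ^ 3 := pow_le_pow_right₀ (by linarith) (by norm_num)
          gcongr
      _ = _ := by
          field_simp
          ring
  have hi : Integrable (fun ξ : Fin n → ℝ => ((pairInner fun i => ξ i ^ 2) / N - 1) ^ 2)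
      (Measure.pi fun _ => gaussianReal 0 1) := by
    have hm : Measurable fun ξ : Fin n → ℝ => ((pairInner fun i => ξ i ^ 2) / N - 1) ^ 2 := by
      fun_prop
    refine ⟨hm.aestronglyMeasurable, ?_⟩
    rw [hasFiniteIntegral_iff_ofReal (ae_of_all _ fun x => by positivity)]
    exact hle.trans_lt ENNReal.ofReal_lt_top
  refine ⟨hi, (ENNReal.ofReal_le_ofReal_iff (by positivity)).1 ?_⟩
  rw [ofReal_integral_eq_lintegral_ofReal hi (ae_of_all _ fun x => by positivity)]
  exact hle

theorem charFun_statT1_null (PX : Measure (Design n p)) [IsProbabilityMeasure PX] (t : ℝ) :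
    Integrable (fun ξ : Fin n → ℝ => charFun (PX.map fun X => ∑ j, pairInner fun i => ξ i * X i j)
        (t / Real.sqrt ((n : ℝ) * (n - 1) / 2) / Real.sqrt p))
        (Measure.pi fun _ => gaussianReal 0 1) ∧
    charFun ((modelLaw PX 0).map statT1) t =
      ∫ ξ : Fin n → ℝ, charFun (PX.map fun X => ∑ j, pairInner fun i => ξ i * X i j)
        (t / Real.sqrt ((n : ℝ) * (n - 1) / 2) / Real.sqrt p)
        ∂(Measure.pi fun _ => gaussianReal 0 1) := by
  have hT := measurable_statT1 (n := n) (p := p)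
  have hR := measurable_response (n := n) (0 : EuclideanSpace ℝ (Fin p))
  have hint : Integrable (fun w : Design n p × (Fin n → ℝ) =>
      Complex.exp ((t : ℂ) * (statT1 (w.1, response 0 w.1 w.2) : ℝ) * Complex.I))
      (PX.prod (Measure.pi fun _ => gaussianReal 0 1)) := by
    have hm := hT.comp hR
    have hm' : Measurable fun w : Design n p × (Fin n → ℝ) =>
        Complex.exp ((t : ℂ) * ((statT1 ∘ fun w : Design n p × (Fin n → ℝ) =>
          (w.1, response 0 w.1 w.2)) w : ℝ) * Complex.I) := by fun_prop
    refine Integrable.of_bound hm'.aestronglyMeasurable 1 (ae_of_all _ fun x => ?_)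
    rw [← Complex.ofReal_mul, Complex.norm_exp_ofReal_mul_I]
  have e : ∀ ξ : Fin n → ℝ,
      ∫ X, Complex.exp ((t : ℂ) * (statT1 (X, response 0 X ξ) : ℝ) * Complex.I) ∂PX =
      charFun (PX.map fun X => ∑ j, pairInner fun i => ξ i * X i j)
        (t / Real.sqrt ((n : ℝ) * (n - 1) / 2) / Real.sqrt p) := by
    intro ξ
    have hW : Measurable fun X : Design n p => ∑ j, pairInner fun i => ξ i * X i j :=
      Finset.measurable_sum _ fun j _ => measurable_pairInner.comp (by fun_prop)
    rw [charFun_apply_real, integral_map hW.aemeasurable (by fun_prop)]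
    refine integral_congr_ae (ae_of_all _ fun X => ?_)
    dsimp only
    rw [response_zero, statT1_eq_sum_columns]
    congr 1
    push_cast
    ring
  simp_rw [← e]
  refine ⟨hint.integral_prod_right, ?_⟩
  rw [charFun_apply_real, integral_map hT.aemeasurable (by fun_prop), modelLaw,
    integral_map hR.aemeasurable (by fun_prop), integral_prod_symm _ hint]

theorem norm_exp_neg_sub_exp_neg_le {a b : ℝ} (ha : 0 ≤ a) (hb : 0 ≤ b) :
    ‖Complex.exp ((-a : ℝ)) - Complex.exp ((-b : ℝ))‖ ≤ |a - b| := by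
  rw [← Complex.ofReal_exp, ← Complex.ofReal_exp, ← Complex.ofReal_sub, Complex.norm_real,
    Real.norm_eq_abs]
  have key : ∀ {x y : ℝ}, 0 ≤ x → x ≤ y → Real.exp (-x) - Real.exp (-y) ≤ y - x := by
    intro x y hx hxy
    have h1 : Real.exp (-y) = Real.exp (-x) * Real.exp (-(y - x)) := by
      rw [← Real.exp_add]; congr 1; ring
    have h2 : Real.exp (-x) ≤ 1 := Real.exp_le_one_iff.2 (by linarith)
    have h3 := Real.one_sub_le_exp_neg (y - x)
    rw [h1]
    nlinarith [Real.exp_pos (-x)]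
  rcases le_total a b with h | h
  · rw [abs_of_nonneg (sub_nonneg.2 (Real.exp_le_exp.2 (by linarith))), abs_sub_comm,
      abs_of_nonneg (by linarith)]
    exact key ha h
  · rw [abs_sub_comm, abs_of_nonneg (sub_nonneg.2 (Real.exp_le_exp.2 (by linarith))),
      abs_of_nonneg (by linarith)]
    exact key hb h

/-- Berry-Esseen type bound for the characteristic function of `statT1` under the null. -/
theorem exists_charFun_statT1_bound {C : ℝ} (hC : 1 ≤ C) : ∃ K : ℝ → ℝ, ∀ (n p : ℕ), 2 ≤ n → 1 ≤ p →
    ∀ (PX : Measure (Design n p)) (ν : Fin p → Measure ℝ), IsProbabilityMeasure PX →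
    (∀ j, Standardized C (ν j)) →
    PX.map (fun X j i => X i j) = (Measure.pi fun j => Measure.pi fun _ : Fin n => ν j) → ∀ t,
    ‖charFun ((modelLaw PX 0).map statT1) t - charFun (gaussianReal 0 1) t‖ ≤
      K t * (1 / Real.sqrt p + 1 / Real.sqrt n) := by
  obtain ⟨L, hL⟩ := exists_integral_pairInner_gaussian_sq_le
  set M := ∫ x, x ^ 8 ∂(gaussianReal 0 1) with hM
  refine ⟨fun t => (1 + 768 * t ^ 4 * C ^ 2 * M) + t ^ 2 * (1 + L) / 4, ?_⟩
  intro n p hn hp PX ν hPX hν hmap t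
  have hn2 : (2 : ℝ) ≤ n := by exact_mod_cast hn
  have hp1 : (1 : ℝ) ≤ p := by exact_mod_cast hp
  have hN := sq_div_four_le_pairCount hn
  obtain ⟨hyi, hyb⟩ := hL n hn
  obtain ⟨hgi, hg⟩ := charFun_statT1_null PX t
  set N := (n : ℝ) * (n - 1) / 2 with hNdef
  have hNpos : 0 < N := lt_of_lt_of_le (by positivity) hN
  have hsN2 : Real.sqrt N ^ 2 = N := Real.sq_sqrt hNpos.le
  have hsn : 0 < Real.sqrt n := Real.sqrt_pos.2 (by linarith)
  have hsn2 : Real.sqrt n ^ 2 = n := Real.sq_sqrt (by linarith)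
  have hsp : 0 < Real.sqrt p := Real.sqrt_pos.2 (by linarith)
  let y : (Fin n → ℝ) → ℝ := fun ξ => (pairInner fun i => ξ i ^ 2) / N - 1
  have i8 : Integrable (fun x : ℝ => x ^ 8) (gaussianReal 0 1) := by
    have := (memLp_id_gaussianReal (μ := 0) (v := 1) 8).integrable_norm_pow (by norm_num)
    simpa [Even.pow_abs (by decide : Even 8)] using this
  have i8' : ∀ i : Fin n, Integrable (fun ξ : Fin n → ℝ => ξ i ^ 8)
      (Measure.pi fun _ => gaussianReal 0 1) := fun i =>
    (measurePreserving_eval (fun _ : Fin n => gaussianReal 0 1) i).integrable_comp_of_integrable i8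
  have e8 : ∀ i : Fin n, ∫ ξ : Fin n → ℝ, ξ i ^ 8 ∂(Measure.pi fun _ => gaussianReal 0 1) = M := by
    intro i
    have hmp := measurePreserving_eval (fun _ : Fin n => gaussianReal 0 1) i
    have := integral_map (μ := Measure.pi fun _ : Fin n => gaussianReal 0 1)
      hmp.measurable.aemeasurable (f := fun x : ℝ => x ^ 8) (by fun_prop)
    rw [hmp.map_eq] at this
    exact this.symm
  have hG1 : Integrable (fun ξ : Fin n → ℝ => ∑ i, ξ i ^ 8)
      (Measure.pi fun _ => gaussianReal 0 1) := integrable_finsetSum _ fun i _ => i8' i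
  have hpoint : ∀ ξ : Fin n → ℝ,
      ‖charFun (PX.map fun X => ∑ j, pairInner fun i => ξ i * X i j)
        (t / Real.sqrt N / Real.sqrt p) - Complex.exp ((-(t ^ 2 / 2) : ℝ))‖ ≤
      (1 / Real.sqrt p + 768 * t ^ 4 * C ^ 2 / n / Real.sqrt p * ∑ i, ξ i ^ 8) +
        (t ^ 2 / 4 / Real.sqrt n + t ^ 2 / 4 * Real.sqrt n * y ξ ^ 2) := by
    intro ξ
    have h1 := norm_charFun_sum_columns_sub_le hC hν hmap hp ξ (t / Real.sqrt N)
    have hv0 : 0 ≤ pairInner fun i => ξ i ^ 2 := Finset.sum_nonneg fun q _ => by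
      rw [Real.inner_apply]
      positivity
    have h2 := norm_exp_neg_sub_exp_neg_le
      (a := (t / Real.sqrt N) ^ 2 * (pairInner fun i => ξ i ^ 2) / 2) (b := t ^ 2 / 2)
      (by positivity) (by positivity)
    refine (norm_sub_le_norm_sub_add_norm_sub _ _ _).trans
      (add_le_add (h1.trans ?_) (h2.trans ?_))
    -- The power mean inequality makes the error linear in the `ξ i ^ 8`, with factor `n³ / n⁴`;
    -- their `n` equal expectations cancel the remaining `1/n`. The constant `768` is `48 * 16`.
    · have hpow : (∑ i, ξ i ^ 2) ^ 4 ≤ (n : ℝ) ^ 3 * ∑ i, ξ i ^ 8 := by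
        have := pow_sum_div_card_le_sum_pow (s := Finset.univ) (f := fun i => ξ i ^ 2)
          (fun i _ => sq_nonneg _) 3
        simp only [Finset.card_univ, Fintype.card_fin, ← pow_mul] at this
        rw [div_le_iff₀ (by positivity)] at this
        norm_num at this
        linarith
      have hs4 : (t / Real.sqrt N) ^ 4 ≤ 16 * t ^ 4 / n ^ 4 := by
        rw [div_pow, show Real.sqrt N ^ 4 = (Real.sqrt N ^ 2) ^ 2 by ring, hsN2]
        calc t ^ 4 / N ^ 2 ≤ t ^ 4 / ((n : ℝ) ^ 2 / 4) ^ 2 := by gcongr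
          _ = _ := by field_simp; ring
      calc _ ≤ (1 + 48 * (16 * t ^ 4 / n ^ 4) * (C ^ 2 * ((n : ℝ) ^ 3 * ∑ i, ξ i ^ 8))) /
            Real.sqrt p := by gcongr
        _ = _ := by
          field_simp
          ring
    · have e1 : (t / Real.sqrt N) ^ 2 * (pairInner fun i => ξ i ^ 2) / 2 - t ^ 2 / 2 =
          t ^ 2 / 2 * y ξ := by
        simp only [y]
        rw [div_pow, hsN2]
        field_simp
      rw [e1, abs_mul, abs_of_nonneg (by positivity)]
      -- Weighted AM-GM: since `y²` has mean at most `L/n`, the weight `√n` makes both terms of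
      -- order `n^{-1/2}` on average.
      have e2 : |y ξ| ≤ (1 / Real.sqrt n + Real.sqrt n * y ξ ^ 2) / 2 := by
        have : 1 / Real.sqrt n + Real.sqrt n * y ξ ^ 2 - 2 * |y ξ| =
            (1 - Real.sqrt n * |y ξ|) ^ 2 / Real.sqrt n := by
          rw [← sq_abs (y ξ)]
          field_simp
          ring
        have h0 : 0 ≤ (1 - Real.sqrt n * |y ξ|) ^ 2 / Real.sqrt n := by positivity
        linarith
      calc _ ≤ t ^ 2 / 2 * ((1 / Real.sqrt n + Real.sqrt n * y ξ ^ 2) / 2) := by gcongr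
        _ = _ := by ring
  have hgauss : charFun (gaussianReal 0 1) t = Complex.exp ((-(t ^ 2 / 2) : ℝ)) := by
    rw [charFun_gaussianReal]
    congr 1
    push_cast
    ring
  have hF1 : Integrable (fun ξ : Fin n → ℝ => 1 / Real.sqrt p +
      768 * t ^ 4 * C ^ 2 / n / Real.sqrt p * ∑ i, ξ i ^ 8)
      (Measure.pi fun _ => gaussianReal 0 1) := (integrable_const _).add (hG1.const_mul _)
  have hF2 : Integrable (fun ξ : Fin n → ℝ => t ^ 2 / 4 / Real.sqrt n +
      t ^ 2 / 4 * Real.sqrt n * y ξ ^ 2)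
      (Measure.pi fun _ => gaussianReal 0 1) := (integrable_const _).add (hyi.const_mul _)
  have hsub : ∫ ξ : Fin n → ℝ, charFun (PX.map fun X => ∑ j, pairInner fun i => ξ i * X i j)
        (t / Real.sqrt N / Real.sqrt p) ∂(Measure.pi fun _ => gaussianReal 0 1) -
        Complex.exp ((-(t ^ 2 / 2) : ℝ)) =
      ∫ ξ : Fin n → ℝ, (charFun (PX.map fun X => ∑ j, pairInner fun i => ξ i * X i j)
        (t / Real.sqrt N / Real.sqrt p) - Complex.exp ((-(t ^ 2 / 2) : ℝ)))
        ∂(Measure.pi fun _ => gaussianReal 0 1) := by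
    rw [integral_sub hgi (integrable_const _)]
    simp
  have hM0 : 0 ≤ M := integral_nonneg fun x => by positivity
  have hL0 : 0 ≤ L := by
    have : 0 ≤ L / n := le_trans (integral_nonneg fun ξ => sq_nonneg _) hyb
    by_contra! hneg
    exact absurd (div_neg_of_neg_of_pos hneg (by linarith : (0 : ℝ) < n)) (not_lt.2 this)
  rw [hg, hgauss, hsub]
  refine (norm_integral_le_of_norm_le (hF1.add hF2) (ae_of_all _ hpoint)).trans ?_
  have hI : ∫ ξ : Fin n → ℝ, y ξ ^ 2 ∂(Measure.pi fun _ => gaussianReal 0 1) ≤ L / n := hyb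
  have hval : ∫ ξ : Fin n → ℝ, ((1 / Real.sqrt p + 768 * t ^ 4 * C ^ 2 / n / Real.sqrt p *
        ∑ i, ξ i ^ 8) + (t ^ 2 / 4 / Real.sqrt n + t ^ 2 / 4 * Real.sqrt n * y ξ ^ 2))
        ∂(Measure.pi fun _ => gaussianReal 0 1) ≤
      (1 + 768 * t ^ 4 * C ^ 2 * M) * (1 / Real.sqrt p) +
        t ^ 2 * (1 + L) / 4 * (1 / Real.sqrt n) := by
    rw [integral_add hF1 hF2, integral_add (integrable_const _) (hG1.const_mul _),
      integral_add (integrable_const _) (hyi.const_mul _), integral_const_mul,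
      integral_const_mul, integral_finsetSum _ fun i _ => i8' i]
    simp only [e8, integral_const, probReal_univ, smul_eq_mul, one_mul, Finset.sum_const,
      Finset.card_univ, Fintype.card_fin, nsmul_eq_mul]
    refine add_le_add (le_of_eq ?_) ?_
    · field_simp
    · calc _ ≤ t ^ 2 / 4 / Real.sqrt n + t ^ 2 / 4 * Real.sqrt n * (L / n) := by gcongr
        _ = _ := by
          nth_rewrite 3 [← hsn2]
          field_simp
  refine hval.trans ?_
  have a1 : 0 ≤ 1 + 768 * t ^ 4 * C ^ 2 * M := by positivity
  have a2 : 0 ≤ t ^ 2 * (1 + L) / 4 := by positivity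
  have b1 : 0 ≤ 1 / Real.sqrt p := by positivity
  have b2 : 0 ≤ 1 / Real.sqrt n := by positivity
  nlinarith [mul_nonneg a1 b2, mul_nonneg a2 b1]

end TypeOne

/-! ### Passage to the limit -/

section Limits

theorem typeIError_eq {n p : ℕ} (PX : Measure (Design n p)) (α : ℝ) :
    typeIError PX (testPsi1 n p α) =
      ((modelLaw PX 0).map statT1).real (Set.Ioi (gaussianUpperQuantile α)) := by
  have hm := measurable_statT1 (n := n) (p := p)
  rw [typeIError, testPsi1, integral_indicator_one (measurableSet_lt measurable_const hm),
    measureReal_def, measureReal_def, Measure.map_apply hm measurableSet_Ioi]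
  rfl

theorem eventually_exists_marginals {ι : Type*} {l : Filter ι} {n p : ι → ℕ}
    (hn : Tendsto n l atTop) (hp : Tendsto p l atTop)
    {PX : ∀ m, Measure (Design (n m) (p m))} [∀ m, IsProbabilityMeasure (PX m)]
    (hX : ∀ m, IsStandardDesign (PX m)) (hA2 : ∀ m, IndependentDesign (PX m))
    (hB1 : BoundedProductMoments l n p PX) :
    ∃ C : ℝ, 1 ≤ C ∧ ∀ᶠ m in l, 2 ≤ n m ∧ 2 ≤ p m ∧ ∃ ν : Fin (p m) → Measure ℝ,
      (∀ j, Standardized C (ν j)) ∧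
      PX m = Measure.pi (fun _ : Fin (n m) => Measure.pi ν) ∧
      (PX m).map (fun X j i => X i j) =
        Measure.pi fun j => Measure.pi fun _ : Fin (n m) => ν j := by
  obtain ⟨C, hC⟩ := hB1
  refine ⟨max 1 C, le_max_left _ _, ?_⟩
  filter_upwards [hC, hn.eventually_ge_atTop 2, hp.eventually_ge_atTop 2] with m hm hnm hpm
  obtain ⟨ν, hν, h1, h2⟩ := exists_standardized_marginals (hX m) (hA2 m) (by omega) hpm hm
  refine ⟨hnm, hpm, ν, fun j => ?_, h1, h2⟩
  exact { hν j with fourth := (hν j).fourth.trans (le_max_right _ _) }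

theorem tendsto_one_div_sqrt_natCast {ι : Type*} {l : Filter ι} {n : ι → ℕ}
    (hn : Tendsto n l atTop) : Tendsto (fun m => 1 / Real.sqrt (n m)) l (𝓝 0) := by
  simp only [one_div]
  exact tendsto_inv_atTop_zero.comp
    (Real.tendsto_sqrt_atTop.comp (tendsto_natCast_atTop_atTop.comp hn))

theorem tendsto_typeIError {ι : Type*} {l : Filter ι} {n p : ι → ℕ}
    (hn : Tendsto n l atTop) (hp : Tendsto p l atTop)
    {PX : ∀ m, Measure (Design (n m) (p m))} [∀ m, IsProbabilityMeasure (PX m)]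
    (hX : ∀ m, IsStandardDesign (PX m)) (hA2 : ∀ m, IndependentDesign (PX m))
    (hB1 : BoundedProductMoments l n p PX) {α : ℝ} (hα : α ∈ Set.Ioo (0 : ℝ) 1) :
    Tendsto (fun m => typeIError (PX m) (testPsi1 (n m) (p m) α)) l (𝓝 α) := by
  obtain ⟨C, hC1, hC⟩ := eventually_exists_marginals hn hp hX hA2 hB1
  obtain ⟨K, hK⟩ := exists_charFun_statT1_bound hC1
  have : NullSingletonClass (gaussianReal 0 1) := nullSingletonClass_gaussianReal (by norm_num)
  refine Metric.tendsto_nhds.2 fun ε hε => ?_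
  -- The absolute value makes the profile nonnegative, so that it is monotone in `δ`.
  obtain ⟨δ, hδ, h⟩ := exists_delta_of_charFun_bound (gaussianReal 0 1) (fun t => |K t|)
    (gaussianUpperQuantile α) hε
  have hlim : Tendsto (fun m => 1 / Real.sqrt (p m) + 1 / Real.sqrt (n m)) l (𝓝 0) := by
    simpa using (tendsto_one_div_sqrt_natCast hp).add (tendsto_one_div_sqrt_natCast hn)
  filter_upwards [hC, hlim.eventually (eventually_lt_nhds hδ)] with m hm hδm
  obtain ⟨hnm, hpm, ν, hν, -, hmap⟩ := hm
  have hprob := isProbabilityMeasure_modelLaw (PX m) 0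
  have := h ((modelLaw (PX m) 0).map statT1)
    (Measure.isProbabilityMeasure_map measurable_statT1.aemeasurable) fun t => by
      refine (hK (n m) (p m) hnm (by omega) (PX m) ν inferInstance hν hmap t).trans ?_
      have h0 : 0 ≤ 1 / Real.sqrt (p m) + 1 / Real.sqrt (n m) := by positivity
      exact mul_le_mul (le_abs_self _) hδm.le h0 (abs_nonneg _)
  rwa [gaussianReal_Ioi_quantile hα, ← typeIError_eq, ← Real.dist_eq] at this

/-- Let `b = (A + 1/r²)√p/n = A√p/n + √p/(nr²)`. The two rate conditions say that each summand
vanishes, and the bound is `128(b/√p + b²)`. -/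
theorem tendsto_typeII_bound {ι : Type*} {l : Filter ι} {n p : ι → ℕ}
    (hp : Tendsto p l atTop)
    (hpn : (fun m => (p m : ℝ)) =o[l] (fun m => (n m : ℝ) ^ 2)) {r : ι → ℝ}
    (hr : Tendsto (fun m => (n m : ℝ) * r m ^ 2 / Real.sqrt (p m)) l atTop) (A : ℝ) :
    Tendsto (fun m => 128 * ((A + 1 / r m ^ 2) / n m + (A + 1 / r m ^ 2) ^ 2 *
      (p m / (n m : ℝ) ^ 2))) l (𝓝 0) := by
  have hd : Tendsto (fun m => Real.sqrt (p m) / n m) l (𝓝 0) := by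
    have h := hpn.tendsto_div_nhds_zero.sqrt
    rw [Real.sqrt_zero] at h
    refine h.congr fun m => ?_
    rw [Real.sqrt_div (Nat.cast_nonneg _), Real.sqrt_sq (Nat.cast_nonneg _)]
  have he : Tendsto (fun m => Real.sqrt (p m) / (n m * r m ^ 2)) l (𝓝 0) := by
    refine (tendsto_inv_atTop_zero.comp hr).congr fun m => ?_
    simp [inv_div]
  have hs := tendsto_one_div_sqrt_natCast hp
  have hb : Tendsto (fun m => A * (Real.sqrt (p m) / n m) +
      Real.sqrt (p m) / (n m * r m ^ 2)) l (𝓝 0) := by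
    simpa using (hd.const_mul A).add he
  have hlim : Tendsto (fun m => 128 * ((A * (Real.sqrt (p m) / n m) +
      Real.sqrt (p m) / (n m * r m ^ 2)) * (1 / Real.sqrt (p m)) +
      (A * (Real.sqrt (p m) / n m) + Real.sqrt (p m) / (n m * r m ^ 2)) ^ 2)) l (𝓝 0) := by
    simpa using ((hb.mul hs).add (hb.pow 2)).const_mul 128
  refine hlim.congr' ?_
  filter_upwards [hp.eventually_ge_atTop 1] with m hpm
  have hp1 : (1 : ℝ) ≤ p m := by exact_mod_cast hpm
  have hsp : 0 < Real.sqrt (p m) := Real.sqrt_pos.2 (by linarith)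
  have e : A * (Real.sqrt (p m) / n m) + Real.sqrt (p m) / (n m * r m ^ 2) =
      (A + 1 / r m ^ 2) / n m * Real.sqrt (p m) := by
    rw [div_mul_eq_div_div]
    ring
  rw [e, mul_assoc, mul_one_div_cancel hsp.ne', mul_one, mul_pow, Real.sq_sqrt (by linarith)]
  ring

theorem tendsto_typeIIError {ι : Type*} {l : Filter ι} {n p : ι → ℕ}
    (hn : Tendsto n l atTop) (hp : Tendsto p l atTop)
    {PX : ∀ m, Measure (Design (n m) (p m))} [∀ m, IsProbabilityMeasure (PX m)]
    (hX : ∀ m, IsStandardDesign (PX m)) (hA2 : ∀ m, IndependentDesign (PX m))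
    (hB1 : BoundedProductMoments l n p PX) (α : ℝ)
    (hpn : (fun m => (p m : ℝ)) =o[l] (fun m => (n m : ℝ) ^ 2)) {r : ι → ℝ}
    (hr0 : ∀ m, 0 < r m)
    (hr : Tendsto (fun m => (n m : ℝ) * r m ^ 2 / Real.sqrt (p m)) l atTop) :
    Tendsto (fun m => typeIIError (PX m) (testPsi1 (n m) (p m) α) (alternative (p m) (r m)))
      l (𝓝 0) := by
  obtain ⟨C, hC1, hC⟩ := eventually_exists_marginals hn hp hX hA2 hB1
  refine squeeze_zero' (Eventually.of_forall fun m => ?_) ?_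
    (tendsto_typeII_bound hp hpn hr (4 * C))
  · refine Real.iSup_nonneg fun θ => ?_
    rw [typeIIErrorAt_eq]
    exact measureReal_nonneg
  · filter_upwards [hC, hr.eventually_ge_atTop (4 * gaussianUpperQuantile α)] with m hm hrm
    obtain ⟨hnm, hpm, ν, hν, hpi, -⟩ := hm
    have hC0 : 0 < C := by linarith
    refine Real.iSup_le (fun θ => ?_) (by positivity)
    rw [hpi]
    refine typeIIErrorAt_le hC1 hν hnm (by omega) (hr0 m) ?_ θ θ.2
    rw [mul_comm 4 (Real.sqrt _), ← div_div]
    linarith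

end Limits

end SparseRegression

theorem theorem3 {ι : Type*} (l : Filter ι) (n p : ι → ℕ)
    (hn : Tendsto n l atTop) (hp : Tendsto p l atTop)
    (PX : ∀ m, Measure (SparseRegression.Design (n m) (p m)))
    [∀ m, IsProbabilityMeasure (PX m)]
    (hX : ∀ m, SparseRegression.IsStandardDesign (PX m))
    (hA2 : ∀ m, SparseRegression.IndependentDesign (PX m))
    (hB1 : SparseRegression.BoundedProductMoments l n p PX)
    (α : ℝ) (hα : α ∈ Set.Ioo (0 : ℝ) 1) :
    Tendsto (fun m =>
        SparseRegression.typeIError (PX m) (SparseRegression.testPsi1 (n m) (p m) α)) l (𝓝 α) ∧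
    ((fun m => (p m : ℝ)) =o[l] (fun m => (n m : ℝ) ^ 2) →
      ∀ r : ι → ℝ, (∀ m, 0 < r m) →
        Tendsto (fun m => (n m : ℝ) * r m ^ 2 / Real.sqrt (p m)) l atTop →
        Tendsto (fun m =>
          SparseRegression.typeIIError (PX m) (SparseRegression.testPsi1 (n m) (p m) α)
            (SparseRegression.alternative (p m) (r m))) l (𝓝 0)) :=
  ⟨SparseRegression.tendsto_typeIError hn hp hX hA2 hB1 hα, fun hpn _ hr0 hr =>
    SparseRegression.tendsto_typeIIError hn hp hX hA2 hB1 α hpn hr0 hr⟩
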